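/- Let $\mathbb T=\mathbb R/\mathbb Z$ with Haar measure of total mass $1$, and let $e_h(t)=e^{2\pi i h t}$. An idempotent on $\mathbb T$ is a function $f=\sum_{h\in H}e_h$ with $H\subset\mathbb N=\{0,1,2,\dots\}$ finite and nonempty. For $p>0$ let $\gamma_p$ be the supremum of all real $\gamma$ such that for every measurable set $E\subset\mathbb T$ of positive measure with $-E=E$ there is an idempotent $f$ with $$\int_E|f|^p\ \ge\ \gamma\int_{\mathbb T}|f|^p .$$ For an integer $q\ge1$ let $\gamma_p^\sharp(q)$ be the largest real $\gamma$ such that for some nonempty $H\subset\{0,\dots,q-1\}$ the function $f(k)=\sum_{h\in H}e^{2\pi i hk/q}$ on $\mathbb Z/q\mathbb Z$ satisfies $$2|f(1)|^p\ \ge\ \gamma\sum_{k=0}^{q-1}|f(k)|^p ,$$ and put $\gamma_p^\sharp=\liminf_{q\to\infty}\gamma_p^\sharp(q)$. **Proposition.** For every real $p>1$ we have $\gamma_p\ge\gamma_p^\sharp$. In particular $$\gamma_2=\gamma_2^\sharp=\sup_{x>0}\frac{2\sin^2x}{\pi x}.$$ Both assertions hold when the lower limit defining $\gamma_p^\sharp$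 is taken over all integers $q$, and also when it is taken over prime $q$ only. -/

import Mathlib

/-- The idempotent exponential polynomial `∑_{h ∈ H} e_h` on the torus `ℝ/ℤ`, where
`e_h(t) = exp(2πiht)` and `H` is a finite set of natural numbers. -/
noncomputable def torusIdempotent (H : Finset ℕ) (t : UnitAddCircle) : ℂ :=
  ∑ h ∈ H, fourier (h : ℤ) t

/-- `γ` is a constant of `p`-concentration on the torus: every symmetric (Lebesgue) measurable
set `E` of positive measure admits a nonzero idempotent `f` with `∫_E |f|^p ≥ γ ∫_𝕋 |f|^p`.
The measure is the Haar measure of total mass one. -/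
def IsTorusConcentrationConstant (p γ : ℝ) : Prop :=
  ∀ E : Set UnitAddCircle,
    MeasureTheory.NullMeasurableSet E MeasureTheory.volume →
    (∀ t ∈ E, -t ∈ E) →
    0 < MeasureTheory.volume E →
    ∃ H : Finset ℕ, H.Nonempty ∧
      γ * ∫ t : UnitAddCircle, ‖torusIdempotent H t‖ ^ p
        ≤ ∫ t in E, ‖torusIdempotent H t‖ ^ p

/-- The level `γ_p` of `p`-concentration on the torus. For `p > 0` the set of constants contains
`0` and is bounded above by `1`, so this is a genuine supremum (and it is `0` exactly when no
positive constant is admissible). -/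
noncomputable def torusLevel (p : ℝ) : ℝ :=
  sSup {γ : ℝ | IsTorusConcentrationConstant p γ}

/-- The idempotent `∑_{h ∈ H} e_h` on `ℤ/qℤ`, where `e_h(k) = exp(2πihk/q)`; the frequencies are
represented by a subset `H` of `{0, …, q-1}`, the points by natural numbers `k`. -/
noncomputable def cyclicIdempotent (q : ℕ) (H : Finset ℕ) (k : ℕ) : ℂ :=
  ∑ h ∈ H, Complex.exp (2 * Real.pi * Complex.I * h * k / q)

/-- `γ_p^♯(q)`: the largest `γ` such that some nonzero idempotent `f` on `ℤ/qℤ` satisfies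
`2 |f(1)|^p ≥ γ ∑_{k=0}^{q-1} |f(k)|^p`. For `q ≥ 1` and `p > 0` the set of such `γ` contains `0`
and is bounded above by `2`, and the supremum is attained. -/
noncomputable def cyclicLevelAt (p : ℝ) (q : ℕ) : ℝ :=
  sSup {γ : ℝ | ∃ H : Finset ℕ, H ⊆ Finset.range q ∧ H.Nonempty ∧
    γ * ∑ k ∈ Finset.range q, ‖cyclicIdempotent q H k‖ ^ p
      ≤ 2 * ‖cyclicIdempotent q H 1‖ ^ p}

/-- `γ_p^♯ = liminf_{q → ∞} γ_p^♯(q)`, over all positive integers `q`. -/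
noncomputable def cyclicLevel (p : ℝ) : ℝ :=
  Filter.liminf (cyclicLevelAt p) Filter.atTop

/-- The variant of `γ_p^♯` in which `q` tends to infinity through the prime numbers; it is at
least as large as the lower limit over all `q`. -/
noncomputable def cyclicPrimeLevel (p : ℝ) : ℝ :=
  Filter.liminf (cyclicLevelAt p) (Filter.atTop ⊓ Filter.principal {q : ℕ | q.Prime})

/-! Torus from cyclic groups. Let `q` be a large odd prime, let `f` on `ℤ/q` nearly attain
`γ_p^♯(q)`, and let `t` be a density point of `E`. Choose `q` so that some fraction `a/q` satisfies
`|t - a/q| < 1/(qn)`, where `n = kernelOrder q ≈ q^{1/4}`. Since `a` is a unit mod `q`, a dilation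
moves the peak of `f` to `a/q` (`exists_dilation`). Multiply `f(x)` by the Dirichlet kernel
`D_n(qx)`. The spectrum of `f` lies in `{0, …, q-1}`, so the product is again an idempotent, and for
`p > 1` the `p`-th power of its modulus lives essentially within `O(1/(qn))` of the grid `{k/q}`.

Translating the grid by `y/q` is convolution on `ℤ/q` with a kernel at `ℓ¹` distance `O(|y| log q)`
from the unit mass (`sum_norm_shiftKernel_sub_le`). As `log q` is negligible against powers of `n`,
the mass of the product near `k/q` is close to `|f(k/q)|^p` times `q⁻¹ ∫ |D_n|^p`. The arc of radius
`A/(qn)` around `a/q` contains `t`, so `E` fills almost all of it. By symmetry `E` also fills almost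
all of the opposite arc, which is disjoint from it; hence the factor 2.

Good primes exist for almost every `t` by a second-moment argument. The functions `|D_N(qt)|² - N`,
for primes `q` in `(N, N²]`, are mutually orthogonal, so their sum is rarely as negative as it would
be if every `qt` stayed away from `0` (`volume_real_forall_prime_le`).

The case `p = 2`. For the lower bound, take `f` to be an interval of about `xq/π` frequencies and
apply Parseval. For the upper bound, test `E` on tiny arcs at `±1/q` and multiply an arbitrary
idempotent by `D_q(t - 1/q)`, which is about `q` on the arc at `1/q`. The Fourier coefficients of
the product are sums of distinct `q`-th roots of unity. Such a sum of `m` roots is largest for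
consecutive roots (`norm_expSum_inv_le`), where it is a quotient of sines controlled by the supremum
of `2 sin² x / (πx)`. -/

open Real in
/-- The character `x ↦ exp (2πix)` of the real line. -/
noncomputable def unitExp (x : ℝ) : ℂ := Complex.exp (((2 * π * x : ℝ) : ℂ) * Complex.I)

/-! ### Characters and exponential sums on the line -/

lemma unitExp_zero : unitExp 0 = 1 := by simp [unitExp]

lemma unitExp_add (x y : ℝ) : unitExp (x + y) = unitExp x * unitExp y := by
  rw [unitExp, unitExp, unitExp, ← Complex.exp_add]
  congr 1
  push_cast
  ring

lemma norm_unitExp (x : ℝ) : ‖unitExp x‖ = 1 := Complex.norm_exp_ofReal_mul_I _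

lemma unitExp_neg (x : ℝ) : unitExp (-x) = starRingEnd ℂ (unitExp x) := by
  rw [unitExp, unitExp, ← Complex.exp_conj]
  congr 1
  rw [map_mul, Complex.conj_ofReal, Complex.conj_I]
  push_cast
  ring

lemma unitExp_intCast (n : ℤ) : unitExp n = 1 := by
  rw [unitExp, Complex.exp_eq_one_iff]
  exact ⟨n, by push_cast; ring⟩

lemma unitExp_natCast_mul (n : ℕ) (x : ℝ) : unitExp (n * x) = unitExp x ^ n := by
  rw [unitExp, unitExp, ← Complex.exp_nat_mul]
  congr 1
  push_cast
  ring

lemma unitExp_re (x : ℝ) : (unitExp x).re = Real.cos (2 * Real.pi * x) :=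
  Complex.exp_ofReal_mul_I_re _

lemma continuous_unitExp : Continuous unitExp := by
  unfold unitExp
  fun_prop

lemma fourier_coe_eq_unitExp (n : ℤ) (x : ℝ) :
    fourier n (x : UnitAddCircle) = unitExp (n * x) := by
  rw [fourier_coe_apply, unitExp]
  congr 1
  push_cast
  ring

lemma norm_unitExp_sub_one (x : ℝ) : ‖unitExp x - 1‖ = 2 * |Real.sin (Real.pi * x)| := by
  rw [unitExp, mul_comm, Complex.norm_exp_I_mul_ofReal_sub_one, norm_mul, Real.norm_eq_abs,
    Real.norm_eq_abs, abs_two]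
  congr 3
  ring

lemma norm_unitExp_sub_one_le (x : ℝ) : ‖unitExp x - 1‖ ≤ 2 * Real.pi * |x| := by
  rw [unitExp, mul_comm]
  refine Real.norm_exp_I_mul_ofReal_sub_one_le.trans ?_
  rw [Real.norm_eq_abs, abs_mul, abs_of_pos Real.two_pi_pos]

lemma four_mul_abs_le_norm_unitExp_sub_one {x : ℝ} (hx : |x| ≤ 1 / 2) :
    4 * |x| ≤ ‖unitExp x - 1‖ := by
  have h := Real.mul_abs_le_abs_sin (x := Real.pi * x) (by
    rw [abs_mul, abs_of_pos Real.pi_pos]; nlinarith [Real.pi_pos])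
  rw [norm_unitExp_sub_one]
  rw [abs_mul, abs_of_pos Real.pi_pos, ← mul_assoc, div_mul_cancel₀ _ Real.pi_ne_zero] at h
  linarith

/-- The exponential sum `∑_{h ∈ H} exp (2πihx)` as a function on the real line. -/
noncomputable def expSum (H : Finset ℕ) (x : ℝ) : ℂ := ∑ h ∈ H, unitExp (h * x)

lemma continuous_expSum (H : Finset ℕ) : Continuous (expSum H) := by
  unfold expSum
  exact continuous_finsetSum _ fun h _ => continuous_unitExp.comp (by fun_prop)

lemma norm_expSum_le_card (H : Finset ℕ) (x : ℝ) : ‖expSum H x‖ ≤ H.card := by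
  refine (norm_sum_le _ _).trans ?_
  simp [norm_unitExp]

lemma expSum_add_intCast (H : Finset ℕ) (x : ℝ) (n : ℤ) : expSum H (x + n) = expSum H x := by
  refine Finset.sum_congr rfl fun h _ => ?_
  have := unitExp_intCast (h * n)
  push_cast at this
  rw [mul_add, unitExp_add, this, mul_one]

lemma expSum_zero (H : Finset ℕ) : expSum H 0 = H.card := by
  simp [expSum, unitExp_zero]

lemma norm_expSum_neg (H : Finset ℕ) (x : ℝ) : ‖expSum H (-x)‖ = ‖expSum H x‖ := by
  have : expSum H (-x) = starRingEnd ℂ (expSum H x) := by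
    simp only [expSum, map_sum, mul_neg, unitExp_neg]
  rw [this, Complex.norm_conj]

lemma torusIdempotent_coe (H : Finset ℕ) (x : ℝ) :
    torusIdempotent H (x : UnitAddCircle) = expSum H x := by
  refine Finset.sum_congr rfl fun h _ => ?_
  rw [fourier_coe_eq_unitExp, Int.cast_natCast]

lemma continuous_torusIdempotent (H : Finset ℕ) : Continuous (torusIdempotent H) := by
  unfold torusIdempotent
  exact continuous_finsetSum _ fun h _ => (fourier (h : ℤ)).continuous

lemma cyclicIdempotent_eq (q : ℕ) (H : Finset ℕ) (k : ℕ) :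
    cyclicIdempotent q H k = expSum H (k / q) := by
  refine Finset.sum_congr rfl fun h _ => ?_
  rw [unitExp]
  congr 1
  push_cast
  ring

/-! ### The Dirichlet kernel -/

lemma expSum_range_mul (n : ℕ) (x : ℝ) :
    expSum (Finset.range n) x * (unitExp x - 1) = unitExp (n * x) - 1 := by
  simp only [expSum, unitExp_natCast_mul]
  exact geom_sum_mul _ _

/-- In the closed form of the geometric sum the numerator is at most `2` and the denominator at
least `4|x|`. The resulting decay does not depend on `n`. -/
lemma norm_expSum_range_mul_le (n : ℕ) {x : ℝ} (hx : |x| ≤ 1 / 2) :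
    ‖expSum (Finset.range n) x‖ * (2 * |x|) ≤ 1 := by
  have h1 := congrArg norm (expSum_range_mul n x)
  rw [norm_mul] at h1
  have h2 : ‖unitExp (n * x) - 1‖ ≤ 2 :=
    (norm_sub_le _ _).trans (by rw [norm_unitExp, norm_one]; norm_num)
  have h3 := mul_le_mul_of_nonneg_left (four_mul_abs_le_norm_unitExp_sub_one hx)
    (norm_nonneg (expSum (Finset.range n) x))
  linarith

/-- All phases stay within `π/3` of zero, so every term has real part at least `1/2`. -/
lemma half_le_norm_expSum_range {n : ℕ} {x : ℝ} (hx : |x| * (6 * n) ≤ 1) :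
    (n : ℝ) / 2 ≤ ‖expSum (Finset.range n) x‖ := by
  refine le_trans ?_ (Complex.re_le_norm _)
  rw [expSum, Complex.re_sum]
  have : ∀ j ∈ Finset.range n, (1 / 2 : ℝ) ≤ (unitExp (j * x)).re := by
    intro j hj
    have hj' : (j : ℝ) ≤ n := by exact_mod_cast (Finset.mem_range.1 hj).le
    rw [unitExp_re, ← Real.cos_abs, ← Real.cos_pi_div_three]
    have h : |2 * Real.pi * (j * x)| = 2 * Real.pi * (j * |x|) := by
      rw [abs_mul, abs_of_pos Real.two_pi_pos, abs_mul, Nat.abs_cast]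
    rw [h]
    refine Real.cos_le_cos_of_nonneg_of_le_pi (by positivity) (by linarith [Real.pi_pos]) ?_
    have : j * |x| ≤ 1 / 6 := by nlinarith [abs_nonneg x]
    nlinarith [Real.pi_pos]
  have h := Finset.card_nsmul_le_sum _ _ _ this
  rw [Finset.card_range, nsmul_eq_mul] at h
  linarith

/-! ### Shifting the grid `ℤ/q` inside the torus -/

lemma stdAddChar_natCast (q : ℕ) [NeZero q] (j : ℕ) :
    ZMod.stdAddChar (j : ZMod q) = unitExp (j / q) := by
  have := ZMod.stdAddChar_coe (N := q) j
  rw [Int.cast_natCast] at this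
  rw [this, unitExp]
  congr 1
  push_cast
  ring

/-- The values of an exponential sum on the grid `(k + y) / q`, as a function of `k ∈ ℤ/q`. -/
noncomputable def gridValue (q : ℕ) [NeZero q] (H : Finset ℕ) (y : ℝ) (k : ZMod q) : ℂ :=
  ∑ h ∈ H, unitExp (h * y / q) * ZMod.stdAddChar ((h : ZMod q) * k)

lemma gridValue_natCast (q : ℕ) [NeZero q] (H : Finset ℕ) (y : ℝ) (k : ℕ) :
    gridValue q H y (k : ZMod q) = expSum H ((k + y) / q) := by
  refine Finset.sum_congr rfl fun h _ => ?_
  rw [← Nat.cast_mul, stdAddChar_natCast, ← unitExp_add]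
  congr 1
  push_cast
  ring

lemma sum_zmod_eq_sum_range {M : Type*} [AddCommMonoid M] (q : ℕ) [NeZero q] (f : ZMod q → M) :
    ∑ k, f k = ∑ k ∈ Finset.range q, f (k : ZMod q) := by
  refine Finset.sum_bij' (fun k _ => k.val) (fun k _ => (k : ZMod q)) ?_ ?_ ?_ ?_ ?_
  · intro k _; exact Finset.mem_range.2 k.val_lt
  · intro k _; exact Finset.mem_univ _
  · intro k _; exact ZMod.natCast_zmod_val k
  · intro k hk; exact ZMod.val_cast_of_lt (Finset.mem_range.1 hk)
  · intro k _; rw [ZMod.natCast_zmod_val]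

/-- The kernel of the operator shifting the grid `ℤ/q` by `y / q`. -/
noncomputable def shiftKernel (q : ℕ) [NeZero q] (y : ℝ) : ZMod q → ℂ :=
  fun j => (q : ℂ)⁻¹ * gridValue q (Finset.range q) y j

lemma zmod_natCast_inj_of_lt {q : ℕ} [NeZero q] {h h' : ℕ} (hh : h < q) (hh' : h' < q) :
    ((h : ZMod q) = h') ↔ h = h' := by
  rw [ZMod.natCast_eq_natCast_iff]
  exact ⟨fun e => Nat.ModEq.eq_of_lt_of_lt e hh hh', fun e => e ▸ rfl⟩

/-- Orthogonality of characters: convolution with the kernel is the Fourier multiplier `e(hy/q)`.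
The condition `h < q` matters, because this phase depends on the integer `h` and not only on its
residue. -/
lemma sum_shiftKernel_mul_stdAddChar {q : ℕ} [NeZero q] (y : ℝ) {h : ℕ} (hh : h < q) :
    ∑ j, shiftKernel q y j * ZMod.stdAddChar ((h : ZMod q) * (-j)) = unitExp (h * y / q) := by
  have hq : (q : ℂ) ≠ 0 := Nat.cast_ne_zero.2 (NeZero.ne q)
  have key : ∀ h' ∈ Finset.range q, ∑ j : ZMod q,
      ZMod.stdAddChar (j * ((h' : ZMod q) - (h : ZMod q))) = if h' = h then (q : ℂ) else 0 := by
    intro h' hh'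
    rw [AddChar.sum_mulShift _ (ZMod.isPrimitive_stdAddChar q)]
    simp only [sub_eq_zero, ZMod.card, zmod_natCast_inj_of_lt (Finset.mem_range.1 hh') hh,
      Nat.cast_ite, Nat.cast_zero]
  calc ∑ j, shiftKernel q y j * ZMod.stdAddChar ((h : ZMod q) * (-j))
      = ∑ h' ∈ Finset.range q, (q : ℂ)⁻¹ * unitExp (h' * y / q) *
          ∑ j : ZMod q, ZMod.stdAddChar (j * ((h' : ZMod q) - (h : ZMod q))) := by
        simp only [shiftKernel, gridValue, Finset.mul_sum, Finset.sum_mul]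
        rw [Finset.sum_comm]
        refine Finset.sum_congr rfl fun h' _ => Finset.sum_congr rfl fun j _ => ?_
        have : j * ((h' : ZMod q) - (h : ZMod q)) = h' * j + h * (-j) := by ring
        rw [this, AddChar.map_add_eq_mul]
        ring
    _ = unitExp (h * y / q) := by
        rw [Finset.sum_congr rfl fun h' hh' => by rw [key h' hh']]
        simp only [mul_ite, mul_zero, Finset.sum_ite_eq', Finset.mem_range, hh, if_true]
        field_simp

/-- Trigonometric interpolation: for spectra in `{0, …, q-1}`, the values on the translated grid are
a convolution of the values on the original one. -/
lemma gridValue_eq_sum_shiftKernel {q : ℕ} [NeZero q] {H : Finset ℕ} (hH : H ⊆ Finset.range q)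
    (y : ℝ) (k : ZMod q) :
    gridValue q H y k = ∑ j, shiftKernel q y j * gridValue q H 0 (k - j) := by
  simp only [gridValue, Finset.mul_sum]
  rw [Finset.sum_comm]
  refine Finset.sum_congr rfl fun h hh => ?_
  rw [← sum_shiftKernel_mul_stdAddChar y (Finset.mem_range.1 (hH hh)), Finset.sum_mul]
  refine Finset.sum_congr rfl fun j _ => ?_
  have : (h : ZMod q) * (k - j) = h * (-j) + h * k := by ring
  rw [this, AddChar.map_add_eq_mul, mul_zero, zero_div, unitExp_zero]
  ring

lemma norm_shiftKernel_zero_sub_one_le (q : ℕ) [NeZero q] (y : ℝ) :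
    ‖shiftKernel q y 0 - 1‖ ≤ 2 * Real.pi * |y| := by
  have hq : (0 : ℝ) < q := Nat.cast_pos.2 (NeZero.pos q)
  have hq' : (q : ℂ) ≠ 0 := Nat.cast_ne_zero.2 (NeZero.ne q)
  have h1 : shiftKernel q y 0 - 1
      = (q : ℂ)⁻¹ * ∑ h ∈ Finset.range q, (unitExp (h * y / q) - 1) := by
    simp only [shiftKernel, gridValue, mul_zero, AddChar.map_zero_eq_one, mul_one,
      Finset.sum_sub_distrib, Finset.sum_const, Finset.card_range, nsmul_eq_mul, mul_sub,
      inv_mul_cancel₀ hq']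
  have h2 : ‖∑ h ∈ Finset.range q, (unitExp (h * y / q) - 1)‖ ≤ q * (2 * Real.pi * |y|) := by
    refine (norm_sum_le _ _).trans ?_
    have := Finset.sum_le_card_nsmul (Finset.range q) (fun h : ℕ => ‖unitExp (h * y / q) - 1‖)
      (2 * Real.pi * |y|) (fun h hh => by
        refine (norm_unitExp_sub_one_le _).trans ?_
        have hh' : (h : ℝ) ≤ q := by exact_mod_cast (Finset.mem_range.1 hh).le
        rw [abs_div, abs_mul, Nat.abs_cast, Nat.abs_cast]
        gcongr
        rw [div_le_iff₀ hq]
        nlinarith [abs_nonneg y])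
    simpa using this
  rw [h1, norm_mul, norm_inv, Complex.norm_natCast, inv_mul_le_iff₀ hq]
  exact h2

/-- With `u = (j+y)/q` the kernel is `(e(y) - 1) / (q (e(u) - 1))`. The numerator is `O(|y|)`, and
the denominator is governed by the distance from `j` to the multiples `0` and `q` of `q`. -/
lemma norm_shiftKernel_natCast_le {q : ℕ} [NeZero q] {y : ℝ} (hy : |y| ≤ 1 / 2) {j : ℕ}
    (hj : 0 < j) (hjq : j < q) :
    ‖shiftKernel q y (j : ZMod q)‖ ≤ Real.pi * |y| * ((j : ℝ)⁻¹ + ((q - j : ℕ) : ℝ)⁻¹) := by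
  have hq : (0 : ℝ) < q := Nat.cast_pos.2 (NeZero.pos q)
  have hj' : (1 : ℝ) ≤ j := by exact_mod_cast hj
  have hjq' : (j : ℝ) + 1 ≤ q := by exact_mod_cast hjq
  obtain ⟨hy1, hy2⟩ := abs_le.1 hy
  rw [Nat.cast_sub hjq.le]
  set u : ℝ := (j + y) / q with hu
  have hqu : q * u = j + y := by rw [hu]; field_simp
  have hu1 : (j : ℝ) ≤ 2 * (q * u) := by linarith
  have hu2 : (q : ℝ) - j ≤ 2 * (q * (1 - u)) := by linarith
  have hupos : 0 < u := by rw [hu]; apply div_pos _ hq; linarith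
  have hu1' : 0 < 1 - u := by
    have : 0 < q * (1 - u) := by linarith
    exact pos_of_mul_pos_right this hq.le
  have hgeom := congrArg norm (expSum_range_mul q u)
  have hjy : unitExp (q * u) = unitExp y := by
    rw [hqu, unitExp_add, ← Int.cast_natCast, unitExp_intCast, one_mul]
  rw [hjy, norm_mul] at hgeom
  have hy' := norm_unitExp_sub_one_le y
  have hK : q * ‖shiftKernel q y (j : ZMod q)‖ = ‖expSum (Finset.range q) u‖ := by
    rw [shiftKernel, norm_mul, norm_inv, Complex.norm_natCast, gridValue_natCast,
      mul_inv_cancel_left₀ hq.ne']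
  -- `s` is the distance from `u ∈ (0,1)` to the nearest integer.
  have hsin : ∃ s : ℝ, 0 < s ∧ 4 * s ≤ ‖unitExp u - 1‖ ∧ (s = u ∨ s = 1 - u) := by
    rcases le_total u (1 / 2) with h | h
    · refine ⟨u, hupos, ?_, Or.inl rfl⟩
      have := four_mul_abs_le_norm_unitExp_sub_one (x := u) (by rw [abs_of_pos hupos]; exact h)
      rwa [abs_of_pos hupos] at this
    · refine ⟨1 - u, hu1', ?_, Or.inr rfl⟩
      have := four_mul_abs_le_norm_unitExp_sub_one (x := 1 - u)
        (by rw [abs_of_pos hu1']; linarith)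
      rw [abs_of_pos hu1'] at this
      refine this.trans_eq ?_
      rw [norm_unitExp_sub_one, norm_unitExp_sub_one, mul_sub, mul_one, Real.sin_pi_sub]
  obtain ⟨s, hs, hs4, hs'⟩ := hsin
  have hbound : ‖expSum (Finset.range q) u‖ * (4 * s) ≤ 2 * Real.pi * |y| :=
    (mul_le_mul_of_nonneg_left hs4 (norm_nonneg _)).trans (hgeom.trans_le hy')
  have hbound' : ‖shiftKernel q y (j : ZMod q)‖ * (2 * (q * s)) ≤ Real.pi * |y| := by
    rw [← hK] at hbound
    nlinarith
  have hpy : 0 ≤ Real.pi * |y| := by positivity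
  have hqs : 0 < 2 * (q * s) := by positivity
  have h3 : ‖shiftKernel q y (j : ZMod q)‖ ≤ Real.pi * |y| * (2 * (q * s))⁻¹ := by
    rwa [← div_eq_mul_inv, le_div_iff₀ hqs]
  refine h3.trans (mul_le_mul_of_nonneg_left ?_ hpy)
  have hjp : (0 : ℝ) < j := by linarith
  have hqjp : (0 : ℝ) < q - j := by linarith
  rcases hs' with rfl | rfl
  · have := inv_anti₀ hjp hu1
    have := inv_pos.2 hqjp
    linarith
  · have := inv_anti₀ hqjp hu2
    have := inv_pos.2 hjp
    linarith

/-- The constant in the bound for the shift of the grid `ℤ/q`. -/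
noncomputable def shiftConst (q : ℕ) : ℝ := 2 * Real.pi * (2 + Real.log q)

lemma shiftConst_pos {q : ℕ} (hq : 1 ≤ q) : 0 < shiftConst q := by
  have := Real.log_nonneg (x := q) (by exact_mod_cast hq)
  unfold shiftConst
  positivity

/-- The term at `0` costs `2π|y|`. The bounds `1/j` and `1/(q-j)` give two equal harmonic sums,
whence the logarithm in `shiftConst`. -/
lemma sum_norm_shiftKernel_sub_le (q : ℕ) [NeZero q] {y : ℝ} (hy : |y| ≤ 1 / 2) :
    ∑ j, ‖shiftKernel q y j - if j = 0 then 1 else 0‖ ≤ shiftConst q * |y| := by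
  obtain ⟨r, hr⟩ : ∃ r, q = r + 1 := ⟨q - 1, by have := NeZero.pos q; omega⟩
  have hharm : ∑ j ∈ Finset.range r, ((j + 1 : ℕ) : ℝ)⁻¹ ≤ 1 + Real.log q := by
    have h1 := harmonic_le_one_add_log r
    rw [harmonic] at h1
    push_cast at h1 ⊢
    refine h1.trans ?_
    rcases Nat.eq_zero_or_pos r with h0 | h0
    · simp [h0, hr]
    · gcongr
      omega
  have hrefl : ∑ j ∈ Finset.range r, ((q - (j + 1) : ℕ) : ℝ)⁻¹
      = ∑ j ∈ Finset.range r, ((j + 1 : ℕ) : ℝ)⁻¹ := by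
    rw [← Finset.sum_range_reflect]
    refine Finset.sum_congr rfl fun j hj => ?_
    have := Finset.mem_range.1 hj
    congr 2
    omega
  rw [sum_zmod_eq_sum_range]
  have hsplit : ∀ F : ℕ → ℝ, ∑ j ∈ Finset.range q, F j
      = ∑ j ∈ Finset.range r, F (j + 1) + F 0 := by
    intro F; rw [hr, Finset.sum_range_succ']
  rw [hsplit]
  have h0 : ‖shiftKernel q y ((0 : ℕ) : ZMod q) - if ((0 : ℕ) : ZMod q) = 0 then 1 else 0‖
      ≤ 2 * Real.pi * |y| := by
    simpa using norm_shiftKernel_zero_sub_one_le q y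
  have h1 : ∀ j ∈ Finset.range r, ‖shiftKernel q y ((j + 1 : ℕ) : ZMod q) -
      if ((j + 1 : ℕ) : ZMod q) = 0 then 1 else 0‖
      ≤ Real.pi * |y| * (((j + 1 : ℕ) : ℝ)⁻¹ + ((q - (j + 1) : ℕ) : ℝ)⁻¹) := by
    intro j hj
    have hjq : j + 1 < q := by have := Finset.mem_range.1 hj; omega
    have hne : ((j + 1 : ℕ) : ZMod q) ≠ 0 := by
      rw [← Nat.cast_zero, Ne, zmod_natCast_inj_of_lt hjq (by omega)]
      omega
    rw [if_neg hne, sub_zero]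
    exact norm_shiftKernel_natCast_le hy (by omega) hjq
  have h2 := Finset.sum_le_sum h1
  rw [← Finset.mul_sum, Finset.sum_add_distrib, hrefl] at h2
  have h3 : 0 ≤ Real.pi * |y| := by positivity
  unfold shiftConst
  nlinarith [mul_le_mul_of_nonneg_left hharm h3]

/-- The `ℓᵖ`-norm of the values of an exponential sum on the grid `ℤ/q`. -/
noncomputable def gridNorm (p : ℝ) (q : ℕ) (H : Finset ℕ) : ℝ :=
  (∑ k ∈ Finset.range q, ‖expSum H (k / q)‖ ^ p) ^ (1 / p)

lemma gridNorm_nonneg (p : ℝ) (q : ℕ) (H : Finset ℕ) : 0 ≤ gridNorm p q H := by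
  unfold gridNorm; positivity

lemma gridNorm_rpow {p : ℝ} (hp : 0 < p) (q : ℕ) (H : Finset ℕ) :
    gridNorm p q H ^ p = ∑ k ∈ Finset.range q, ‖expSum H (k / q)‖ ^ p := by
  rw [gridNorm, ← Real.rpow_mul (by positivity), one_div_mul_cancel hp.ne', Real.rpow_one]

/-- Young's inequality: the difference is the convolution of the kernel minus the unit mass with the
grid values, and each cyclic translate of these has the same `ℓᵖ` norm. The triangle inequality is
where `1 ≤ p` enters. -/
lemma lpNorm_gridValue_sub_le {p : ℝ} (hp : 1 ≤ p) {q : ℕ} [NeZero q] {H : Finset ℕ}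
    (hH : H ⊆ Finset.range q) {y : ℝ} (hy : |y| ≤ 1 / 2) :
    (∑ k, ‖gridValue q H y k - gridValue q H 0 k‖ ^ p) ^ (1 / p)
      ≤ shiftConst q * |y| * gridNorm p q H := by
  have hp0 : 0 < p := by linarith
  have : Fact (1 ≤ ENNReal.ofReal p) := ⟨by simpa using ENNReal.ofReal_le_ofReal hp⟩
  have hpt : (ENNReal.ofReal p).toReal = p := ENNReal.toReal_ofReal hp0.le
  let V : ℝ → PiLp (ENNReal.ofReal p) (fun _ : ZMod q => ℂ) := fun y =>
    WithLp.toLp _ (gridValue q H y)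
  let W : ZMod q → PiLp (ENNReal.ofReal p) (fun _ : ZMod q => ℂ) := fun j =>
    WithLp.toLp _ (fun k => gridValue q H 0 (k - j))
  have hnorm : ∀ v : PiLp (ENNReal.ofReal p) (fun _ : ZMod q => ℂ),
      ‖v‖ = (∑ k, ‖v k‖ ^ p) ^ (1 / p) := by
    intro v
    rw [PiLp.norm_eq_sum (by rw [hpt]; exact hp0), hpt]
  have hW : ∀ j, ‖W j‖ = gridNorm p q H := by
    intro j
    rw [hnorm, gridNorm]
    congr 1
    have h1 : ∑ k, ‖(W j) k‖ ^ p = ∑ k : ZMod q, ‖gridValue q H 0 k‖ ^ p :=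
      Fintype.sum_equiv (Equiv.subRight j) _ _ (fun k => rfl)
    rw [h1, sum_zmod_eq_sum_range]
    refine Finset.sum_congr rfl fun k _ => ?_
    rw [gridValue_natCast, add_zero]
  have hV : V y - V 0 = ∑ j, (shiftKernel q y j - if j = 0 then 1 else 0) • W j := by
    ext k
    simp only [V, W, PiLp.sub_apply, WithLp.ofLp_sum, WithLp.ofLp_smul, Finset.sum_apply,
      Pi.smul_apply, smul_eq_mul, sub_mul, Finset.sum_sub_distrib, ite_mul, one_mul, zero_mul,
      Finset.sum_ite_eq', Finset.mem_univ, if_true, sub_zero]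
    rw [gridValue_eq_sum_shiftKernel hH y k]
  have h := hnorm (V y - V 0)
  have h2 : (∑ k, ‖gridValue q H y k - gridValue q H 0 k‖ ^ p) ^ (1 / p) = ‖V y - V 0‖ := by
    rw [h]; rfl
  rw [h2, hV]
  refine (norm_sum_le _ _).trans ?_
  simp only [norm_smul, hW, ← Finset.sum_mul]
  exact mul_le_mul_of_nonneg_right (sum_norm_shiftKernel_sub_le q hy) (gridNorm_nonneg _ _ _)

lemma norm_expSum_shift_sub_le {p : ℝ} (hp : 1 ≤ p) {q : ℕ} [NeZero q] {H : Finset ℕ}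
    (hH : H ⊆ Finset.range q) {y : ℝ} (hy : |y| ≤ 1 / 2) (k : ℕ) :
    ‖expSum H ((k + y) / q) - expSum H (k / q)‖ ≤ shiftConst q * |y| * gridNorm p q H := by
  have hp0 : 0 < p := by linarith
  refine le_trans ?_ (lpNorm_gridValue_sub_le hp hH hy)
  have h := Finset.single_le_sum (f := fun k : ZMod q =>
    ‖gridValue q H y k - gridValue q H 0 k‖ ^ p) (fun _ _ => by positivity)
    (Finset.mem_univ (k : ZMod q))
  simp only [gridValue_natCast, add_zero] at h
  have h2 := Real.rpow_le_rpow (by positivity) h (by positivity : 0 ≤ 1 / p)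
  rwa [← Real.rpow_mul (norm_nonneg _), mul_one_div_cancel hp0.ne', Real.rpow_one] at h2

lemma sum_norm_expSum_shift_rpow_le {p : ℝ} (hp : 1 ≤ p) {q : ℕ} [NeZero q] {H : Finset ℕ}
    (hH : H ⊆ Finset.range q) {y : ℝ} (hy : |y| ≤ 1 / 2) :
    ∑ k ∈ Finset.range q, ‖expSum H ((k + y) / q)‖ ^ p
      ≤ ((1 + shiftConst q * |y|) * gridNorm p q H) ^ p := by
  have hp0 : 0 < p := by linarith
  have h1 := Real.Lp_add_le Finset.univ (fun k : ZMod q => ‖gridValue q H 0 k‖)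
    (fun k => ‖gridValue q H y k - gridValue q H 0 k‖) hp
  simp only [abs_norm] at h1
  have h0 : (∑ k : ZMod q, ‖gridValue q H 0 k‖ ^ p) ^ (1 / p) = gridNorm p q H := by
    rw [gridNorm, sum_zmod_eq_sum_range]
    simp only [gridValue_natCast, add_zero]
  rw [h0] at h1
  have h2 := h1.trans (add_le_add_right (lpNorm_gridValue_sub_le hp hH hy) _)
  have h3 : ∑ k ∈ Finset.range q, ‖expSum H ((k + y) / q)‖ ^ p
      ≤ ∑ k : ZMod q, |‖gridValue q H 0 k‖ + ‖gridValue q H y k - gridValue q H 0 k‖| ^ p := by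
    simp only [← gridValue_natCast]
    rw [← sum_zmod_eq_sum_range q (fun k => ‖gridValue q H y k‖ ^ p)]
    refine Finset.sum_le_sum fun k _ => ?_
    refine Real.rpow_le_rpow (norm_nonneg _) ?_ hp0.le
    refine le_trans ?_ (le_abs_self _)
    simpa using norm_add_le (gridValue q H 0 k) (gridValue q H y k - gridValue q H 0 k)
  refine h3.trans ?_
  have h4 := Real.rpow_le_rpow (by positivity) h2 hp0.le
  rw [← Real.rpow_mul (by positivity), one_div_mul_cancel hp0.ne', Real.rpow_one] at h4
  refine h4.trans_eq ?_
  ring_nf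

/-! ### Arcs, decomposition of integrals along the grid, and product spectra -/

/-- The closed arc of the circle with centre `c` and half-length `r`. -/
def circleArc (c r : ℝ) : Set UnitAddCircle := Metric.closedBall (c : UnitAddCircle) r

lemma measurableSet_circleArc (c r : ℝ) : MeasurableSet (circleArc c r) :=
  Metric.isClosed_closedBall.measurableSet

lemma mem_circleArc {c r x : ℝ} :
    (x : UnitAddCircle) ∈ circleArc c r ↔ ‖((x - c : ℝ) : UnitAddCircle)‖ ≤ r := by
  rw [circleArc, Metric.mem_closedBall, dist_eq_norm, AddCircle.coe_sub]

open MeasureTheory in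
/-- Integrals over small balls of the circle, as integrals on the real line. -/
lemma setIntegral_circleArc (F : UnitAddCircle → ℝ) (c : ℝ) {r : ℝ} (hr : 0 ≤ r)
    (hr' : r < 1 / 2) :
    ∫ t in circleArc c r, F t = ∫ x in (c - r)..(c + r), F x := by
  rw [← integral_indicator (measurableSet_circleArc c r),
    ← UnitAddCircle.integral_preimage (c - 1 / 2)]
  have h1 : Set.EqOn
      (fun x : ℝ => (circleArc c r).indicator F (x : UnitAddCircle))
      ((Set.Icc (c - r) (c + r)).indicator fun x : ℝ => F x)
      (Set.Ioc (c - 1 / 2) (c - 1 / 2 + 1)) := by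
    intro x hx
    have hx' : |x - c| ≤ 1 / 2 := abs_le.2 ⟨by linarith [hx.1], by linarith [hx.2]⟩
    have hn : ‖((x - c : ℝ) : UnitAddCircle)‖ = |x - c| :=
      (AddCircle.norm_coe_eq_abs_iff 1 one_ne_zero).2 (by rwa [abs_one])
    have hmem : (x : UnitAddCircle) ∈ circleArc c r ↔
        x ∈ Set.Icc (c - r) (c + r) := by
      rw [mem_circleArc, hn, abs_le, Set.mem_Icc]
      constructor <;> rintro ⟨h, h'⟩ <;> constructor <;> linarith
    simp only [Set.indicator, hmem]
  rw [setIntegral_congr_fun measurableSet_Ioc h1, setIntegral_indicator measurableSet_Icc]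
  have h2 : Set.Ioc (c - 1 / 2) (c - 1 / 2 + 1) ∩ Set.Icc (c - r) (c + r)
      = Set.Icc (c - r) (c + r) := by
    refine Set.inter_eq_right.2 fun x hx => ⟨by linarith [hx.1], by linarith [hx.2]⟩
  rw [h2, integral_Icc_eq_integral_Ioc, intervalIntegral.integral_of_le (by linarith)]

lemma intervalIntegral_grid_cell (g : ℝ → ℝ) {q : ℝ} (hq : 0 < q) (k b : ℝ) :
    ∫ x in (k / q - b / q)..(k / q + b / q), g x = q⁻¹ * ∫ y in (-b)..b, g ((k + y) / q) := by
  have h := intervalIntegral.integral_comp_add_div (f := g) (a := -b) (b := b) hq.ne' (k / q)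
  rw [smul_eq_mul] at h
  have h2 : ∀ y, k / q + y / q = (k + y) / q := fun y => by ring
  simp only [h2] at h
  rw [h, inv_mul_cancel_left₀ hq.ne']
  congr 1 <;> ring

/-- The `q` cells of length `1/q` centred at the points `k/q` tile a period; each is rescaled to
`[-1/2, 1/2]`. -/
lemma intervalIntegral_eq_sum_grid {g : ℝ → ℝ} (hg : Continuous g) (hper : Function.Periodic g 1)
    {q : ℕ} (hq : 1 ≤ q) :
    ∫ x in (0 : ℝ)..1, g x
      = (q : ℝ)⁻¹ * ∫ y in (-(1 / 2) : ℝ)..(1 / 2), ∑ k ∈ Finset.range q, g ((k + y) / q) := by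
  have hq0 : (0 : ℝ) < q := by exact_mod_cast hq
  have hi : ∀ k ∈ Finset.range q, IntervalIntegrable (fun y : ℝ => g ((k + y) / q))
      MeasureTheory.volume (-(1 / 2)) (1 / 2) :=
    fun k _ => (by fun_prop : Continuous fun y : ℝ => g ((k + y) / q)).intervalIntegrable _ _
  rw [intervalIntegral.integral_finsetSum hi, Finset.mul_sum]
  simp only [← intervalIntegral_grid_cell g hq0]
  have h := intervalIntegral.sum_integral_adjacent_intervals (f := g) (μ := MeasureTheory.volume)
    (a := fun k : ℕ => (k : ℝ) / q - 1 / 2 / q) (n := q)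
    (fun k _ => hg.intervalIntegrable _ _)
  have h2 : ∀ k ∈ Finset.range q, ∫ x in ((k : ℝ) / q - 1 / 2 / q)..((k : ℝ) / q + 1 / 2 / q), g x
      = ∫ x in ((k : ℝ) / q - 1 / 2 / q)..(((k + 1 : ℕ) : ℝ) / q - 1 / 2 / q), g x := by
    intro k _
    congr 1
    push_cast
    ring
  have h3 := hper.intervalIntegral_add_eq (-(1 / 2 / q)) 0
  rw [zero_add] at h3
  rw [Finset.sum_congr rfl h2, h, ← h3]
  congr 1
  · simp
  · rw [div_self hq0.ne']; ring

/-- The spectrum of the product of `∑_{h ∈ H} e_h` with the dilate by `q` of a Dirichlet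
kernel of order `n`. -/
def dirichletProduct (q n : ℕ) (H : Finset ℕ) : Finset ℕ :=
  (H ×ˢ Finset.range n).image fun x => x.1 + q * x.2

lemma dirichletProduct_nonempty {q n : ℕ} {H : Finset ℕ} (hH : H.Nonempty) (hn : 1 ≤ n) :
    (dirichletProduct q n H).Nonempty :=
  (hH.product (Finset.nonempty_range_iff.2 (by omega))).image _

/-- By uniqueness of Euclidean division the frequencies `h + qj` with `h < q` are distinct, so the
product of the two sums has coefficients `0` and `1` only. -/
lemma expSum_dirichletProduct {q n : ℕ} {H : Finset ℕ} (hH : H ⊆ Finset.range q) (x : ℝ) :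
    expSum (dirichletProduct q n H) x = expSum H x * expSum (Finset.range n) (q * x) := by
  rw [expSum, dirichletProduct, Finset.sum_image, Finset.sum_product, expSum, expSum,
    Finset.sum_mul_sum]
  · refine Finset.sum_congr rfl fun h _ => Finset.sum_congr rfl fun j _ => ?_
    rw [← unitExp_add]
    congr 1
    push_cast
    ring
  · rintro ⟨a, b⟩ hx ⟨a', b'⟩ hx' h
    have ha := Finset.mem_range.1 (hH (Finset.mem_product.1 hx).1)
    have ha' := Finset.mem_range.1 (hH (Finset.mem_product.1 hx').1)
    simp only at h ha ha'
    have h1 : a = a' := by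
      have := congrArg (· % q) h
      simpa [Nat.add_mul_mod_self_left, Nat.mod_eq_of_lt ha, Nat.mod_eq_of_lt ha'] using this
    subst h1
    have h2 : b = b' := Nat.eq_of_mul_eq_mul_left (by omega) (Nat.add_left_cancel h)
    rw [h2]

/-! ### `p`-th powers of Dirichlet kernels -/

/-- The integral of the `p`-th power of the Dirichlet kernel of order `n`. -/
noncomputable def dirichletIntegral (p : ℝ) (n : ℕ) : ℝ :=
  ∫ y in (-(1 / 2) : ℝ)..(1 / 2), ‖expSum (Finset.range n) y‖ ^ p

lemma continuous_norm_expSum_rpow {p : ℝ} (hp : 0 ≤ p) (H : Finset ℕ) :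
    Continuous fun y => ‖expSum H y‖ ^ p :=
  (continuous_expSum H).norm.rpow_const fun _ => Or.inr hp

/-- The kernel is at least `n/2` on the interval `|y| ≤ 1/(6n)`, of length `1/(3n)`. -/
lemma le_dirichletIntegral {p : ℝ} (hp : 1 < p) {n : ℕ} (hn : 1 ≤ n) :
    (n : ℝ) ^ (p - 1) / (3 * 2 ^ p) ≤ dirichletIntegral p n := by
  have hn0 : (1 : ℝ) ≤ n := by exact_mod_cast hn
  have hp0 : 0 ≤ p := by linarith
  have hc := continuous_norm_expSum_rpow hp0 (Finset.range n)
  set b : ℝ := 1 / (6 * n) with hb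
  have hb0 : 0 < b := by positivity
  have hb1 : b ≤ 1 / 2 := by
    rw [hb, div_le_div_iff₀ (by positivity) (by norm_num)]; linarith
  have h1 : ∫ y in (-b)..b, ((n : ℝ) / 2) ^ p ≤ ∫ y in (-b)..b, ‖expSum (Finset.range n) y‖ ^ p := by
    refine intervalIntegral.integral_mono_on (by linarith) (by simp) (hc.intervalIntegrable _ _) ?_
    intro y hy
    refine Real.rpow_le_rpow (by positivity) (half_le_norm_expSum_range ?_) hp0
    have : |y| ≤ b := abs_le.2 hy
    rw [hb, le_div_iff₀ (by positivity)] at this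
    exact this
  have h2 : ∫ y in (-b)..b, ‖expSum (Finset.range n) y‖ ^ p ≤ dirichletIntegral p n :=
    intervalIntegral.integral_mono_interval (by linarith) (by linarith) hb1
      (Filter.Eventually.of_forall fun _ => by positivity) (hc.intervalIntegrable _ _)
  refine le_trans (le_of_eq ?_) (h1.trans h2)
  rw [intervalIntegral.integral_const, smul_eq_mul, Real.div_rpow (by positivity) (by norm_num),
    Real.rpow_sub_one (by positivity), hb]
  field_simp
  norm_num

/-- Comparison with `y^(-p)`, whose integral away from zero converges because `p > 1`. At `b = A/n`
the bound is a small multiple of `n^(p-1)` when `A` is large, hence a small part of the whole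
integral. -/
lemma integral_tail_expSum_range_le {p : ℝ} (hp : 1 < p) (n : ℕ) {b : ℝ} (hb : 0 < b)
    (hb' : b ≤ 1 / 2) :
    ∫ y in b..(1 / 2), ‖expSum (Finset.range n) y‖ ^ p ≤ b ^ (1 - p) / (p - 1) := by
  have hp0 : 0 ≤ p := by linarith
  have hc := continuous_norm_expSum_rpow hp0 (Finset.range n)
  have h0 : (0 : ℝ) ∉ Set.uIcc b (1 / 2) := by
    rw [Set.uIcc_of_le hb']; exact fun h => absurd h.1 (by linarith)
  have h1 : ∫ y in b..(1 / 2), ‖expSum (Finset.range n) y‖ ^ p ≤ ∫ y in b..(1 / 2), y ^ (-p) := by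
    refine intervalIntegral.integral_mono_on hb' (hc.intervalIntegrable _ _)
      (intervalIntegral.intervalIntegrable_rpow (Or.inr h0)) ?_
    intro y hy
    have hy0 : 0 < y := by linarith [hy.1]
    have h := norm_expSum_range_mul_le n (x := y) (by rw [abs_of_pos hy0]; exact hy.2)
    rw [abs_of_pos hy0] at h
    rw [Real.rpow_neg hy0.le, ← Real.inv_rpow hy0.le]
    refine Real.rpow_le_rpow (norm_nonneg _) ?_ hp0
    rw [← one_div, le_div_iff₀ hy0]
    nlinarith [norm_nonneg (expSum (Finset.range n) y)]
  refine h1.trans ?_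
  rw [integral_rpow (Or.inr ⟨by linarith, h0⟩)]
  have h2 : (0 : ℝ) ≤ (1 / 2 : ℝ) ^ (1 - p) := by positivity
  have h3 : -p + 1 = 1 - p := by ring
  have h4 : -(1 - p) = p - 1 := by ring
  rw [h3, ← neg_div_neg_eq, h4]
  exact div_le_div_of_nonneg_right (by linarith) (by linarith)

lemma dirichletIntegral_sub_le {p : ℝ} (hp : 1 < p) (n : ℕ) {b : ℝ} (hb : 0 < b)
    (hb' : b ≤ 1 / 2) :
    dirichletIntegral p n - 2 * (b ^ (1 - p) / (p - 1))
      ≤ ∫ y in (-b)..b, ‖expSum (Finset.range n) y‖ ^ p := by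
  have hp0 : 0 ≤ p := by linarith
  have hc := continuous_norm_expSum_rpow hp0 (Finset.range n)
  have hi : ∀ u v, IntervalIntegrable (fun y => ‖expSum (Finset.range n) y‖ ^ p)
    MeasureTheory.volume u v := fun u v => hc.intervalIntegrable u v
  have h1 := integral_tail_expSum_range_le hp n hb hb'
  have h2 := intervalIntegral.integral_comp_neg (a := b) (b := 1 / 2)
    (fun y => ‖expSum (Finset.range n) y‖ ^ p)
  simp only [norm_expSum_neg] at h2
  have h3 := intervalIntegral.integral_add_adjacent_intervals (hi (-(1 / 2)) (-b)) (hi (-b) b)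
  have h4 := intervalIntegral.integral_add_adjacent_intervals (hi (-(1 / 2)) b) (hi b (1 / 2))
  unfold dirichletIntegral
  linarith

/-- Split at `L|y| = η`. Inside, the weight is at most `(1+η)^p`. Outside, the decay of the kernel
absorbs the weight and leaves an error independent of `n`. -/
lemma integral_norm_expSum_range_weight_le {p : ℝ} (hp : 1 < p) (n : ℕ) {L η : ℝ} (hL : 0 < L)
    (hη : 0 < η) :
    ∫ y in (-(1 / 2) : ℝ)..(1 / 2), ‖expSum (Finset.range n) y‖ ^ p * (1 + L * |y|) ^ p
      ≤ (1 + η) ^ p * dirichletIntegral p n + (L * (1 + 1 / η)) ^ p := by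
  have hp0 : 0 ≤ p := by linarith
  have hc := continuous_norm_expSum_rpow hp0 (Finset.range n)
  have hc' : Continuous fun y : ℝ => (1 + L * |y|) ^ p :=
    (by fun_prop : Continuous fun y : ℝ => 1 + L * |y|).rpow_const fun _ => Or.inr hp0
  have h : ∫ y in (-(1 / 2) : ℝ)..(1 / 2), ‖expSum (Finset.range n) y‖ ^ p * (1 + L * |y|) ^ p
      ≤ ∫ y in (-(1 / 2) : ℝ)..(1 / 2),
        ((1 + η) ^ p * ‖expSum (Finset.range n) y‖ ^ p + (L * (1 + 1 / η)) ^ p) := by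
    refine intervalIntegral.integral_mono_on (by norm_num) ((hc.mul hc').intervalIntegrable _ _)
      (((continuous_const.mul hc).add continuous_const).intervalIntegrable _ _) ?_
    intro y hy
    have hy' : |y| ≤ 1 / 2 := abs_le.2 hy
    have hD := norm_nonneg (expSum (Finset.range n) y)
    rcases le_or_gt (L * |y|) η with hle | hgt
    · have : (1 + L * |y|) ^ p ≤ (1 + η) ^ p :=
        Real.rpow_le_rpow (by positivity) (by linarith) hp0
      have h2 : 0 ≤ (L * (1 + 1 / η)) ^ p := by positivity
      have h3 : 0 ≤ ‖expSum (Finset.range n) y‖ ^ p := by positivity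
      nlinarith
    · have h1 := norm_expSum_range_mul_le n hy'
      have h3 : ‖expSum (Finset.range n) y‖ * (1 + L * |y|) ≤ L * (1 + 1 / η) := by
        have hy0 : 0 < |y| := by
          by_contra hcon
          have : |y| = 0 := le_antisymm (not_lt.1 hcon) (abs_nonneg y)
          rw [this] at hgt
          linarith
        have h4 : ‖expSum (Finset.range n) y‖ * η ≤ L := by nlinarith
        have h5 : ‖expSum (Finset.range n) y‖ ≤ L / η := by rwa [le_div_iff₀ hη]
        have h6 : L * (1 + 1 / η) = L + L / η := by ring
        rw [h6]
        nlinarith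
      rw [← Real.mul_rpow hD (by positivity)]
      have h7 := Real.rpow_le_rpow (by positivity) h3 hp0
      have h8 : 0 ≤ (1 + η) ^ p * ‖expSum (Finset.range n) y‖ ^ p := by positivity
      linarith
  refine h.trans_eq ?_
  have hi : IntervalIntegrable (fun y => (1 + η) ^ p * ‖expSum (Finset.range n) y‖ ^ p)
      MeasureTheory.volume (-(1 / 2)) (1 / 2) := (continuous_const.mul hc).intervalIntegrable _ _
  rw [intervalIntegral.integral_add hi (by simp),
    intervalIntegral.integral_const_mul, intervalIntegral.integral_const, dirichletIntegral]
  norm_num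

/-! ### The product idempotent: total mass, and mass on `E` near one fraction -/

open MeasureTheory

lemma continuous_norm_torusIdempotent_rpow {p : ℝ} (hp : 0 ≤ p) (H : Finset ℕ) :
    Continuous fun t => ‖torusIdempotent H t‖ ^ p :=
  (continuous_torusIdempotent H).norm.rpow_const fun _ => Or.inr hp

lemma integrable_norm_torusIdempotent_rpow {p : ℝ} (hp : 0 ≤ p) (H : Finset ℕ) :
    Integrable (fun t : UnitAddCircle => ‖torusIdempotent H t‖ ^ p) :=
  (continuous_norm_torusIdempotent_rpow hp H).integrable_of_hasCompactSupport
    (HasCompactSupport.of_compactSpace _)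

lemma norm_torusIdempotent_neg (H : Finset ℕ) (t : UnitAddCircle) :
    ‖torusIdempotent H (-t)‖ = ‖torusIdempotent H t‖ := by
  induction t using QuotientAddGroup.induction_on with
  | H x =>
    have := norm_expSum_neg H x
    rwa [← torusIdempotent_coe, ← torusIdempotent_coe, AddCircle.coe_neg] at this

lemma expSum_dirichletProduct_grid {q n : ℕ} (hq : 1 ≤ q) {H : Finset ℕ}
    (hH : H ⊆ Finset.range q) (k : ℕ) (y : ℝ) :
    expSum (dirichletProduct q n H) ((k + y) / q)
      = expSum H ((k + y) / q) * expSum (Finset.range n) y := by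
  have hq0 : (q : ℝ) ≠ 0 := by exact_mod_cast (by omega : q ≠ 0)
  rw [expSum_dirichletProduct hH, mul_div_cancel₀ _ hq0, add_comm (k : ℝ) y,
    ← Int.cast_natCast, expSum_add_intCast]

/-- On the grid translated by `y/q` the Dirichlet factor is the constant `D_n(y)`, while the other
factor has `ℓᵖ` norm at most `1 + shiftConst q * |y|` times that on the untranslated grid.
Integration over `y` is then the weighted integral bounded before. -/
lemma integral_dirichletProduct_le {p : ℝ} (hp : 1 < p) {q : ℕ} [NeZero q] (n : ℕ)
    {H : Finset ℕ} (hH : H ⊆ Finset.range q) {η : ℝ} (hη : 0 < η) :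
    q * ∫ t : UnitAddCircle, ‖torusIdempotent (dirichletProduct q n H) t‖ ^ p
      ≤ gridNorm p q H ^ p *
        ((1 + η) ^ p * dirichletIntegral p n + (shiftConst q * (1 + 1 / η)) ^ p) := by
  have hq1 : 1 ≤ q := NeZero.one_le
  have hq0 : (0 : ℝ) < q := by exact_mod_cast hq1
  have hp0 : 0 ≤ p := by linarith
  have hL := shiftConst_pos hq1
  have hG := gridNorm_nonneg p q H
  rw [← UnitAddCircle.intervalIntegral_preimage 0, zero_add]
  simp only [torusIdempotent_coe]
  have hper : Function.Periodic (fun x => ‖expSum (dirichletProduct q n H) x‖ ^ p) 1 := by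
    intro x
    have := expSum_add_intCast (dirichletProduct q n H) x 1
    rw [Int.cast_one] at this
    simp only [this]
  rw [intervalIntegral_eq_sum_grid (continuous_norm_expSum_rpow hp0 _) hper hq1,
    mul_inv_cancel_left₀ hq0.ne']
  refine le_trans ?_ (mul_le_mul_of_nonneg_left
    (integral_norm_expSum_range_weight_le hp n hL hη) (by positivity))
  rw [← intervalIntegral.integral_const_mul]
  have hc := continuous_norm_expSum_rpow hp0 (Finset.range n)
  have hc' : Continuous fun y : ℝ => (1 + shiftConst q * |y|) ^ p :=
    (by fun_prop : Continuous fun y : ℝ => 1 + shiftConst q * |y|).rpow_const fun _ => Or.inr hp0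
  have hc'' := continuous_norm_expSum_rpow hp0 (dirichletProduct q n H)
  refine intervalIntegral.integral_mono_on (by norm_num)
    ((continuous_finsetSum _ fun k _ => hc''.comp (by fun_prop)).intervalIntegrable _ _)
    ((continuous_const.mul (hc.mul hc')).intervalIntegrable _ _) ?_
  intro y hy
  have hy' : |y| ≤ 1 / 2 := abs_le.2 hy
  simp only [expSum_dirichletProduct_grid hq1 hH, norm_mul]
  simp only [Real.mul_rpow (norm_nonneg _) (norm_nonneg _), ← Finset.sum_mul]
  have h := sum_norm_expSum_shift_rpow_le hp.le hH hy'
  rw [Real.mul_rpow (by positivity) hG] at h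
  calc _ ≤ (1 + shiftConst q * |y|) ^ p * gridNorm p q H ^ p *
        ‖expSum (Finset.range n) y‖ ^ p := mul_le_mul_of_nonneg_right h (by positivity)
    _ = _ := by ring

/-- Across the arc the first factor moves from its value at `a/q` by at most `shiftConst q * b *
gridNorm p q H`. The maximum with `0` keeps the base of the power nonnegative. -/
lemma le_integral_circleArc_dirichletProduct {p : ℝ} (hp : 1 < p) {q : ℕ} [NeZero q] (n : ℕ)
    {H : Finset ℕ} (hH : H ⊆ Finset.range q) (a : ℕ) {b : ℝ} (hb : 0 < b) (hb' : b < 1 / 2) :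
    (max 0 (‖expSum H (a / q)‖ - shiftConst q * b * gridNorm p q H)) ^ p *
        (dirichletIntegral p n - 2 * (b ^ (1 - p) / (p - 1)))
      ≤ q * ∫ t in circleArc (a / q) (b / q),
        ‖torusIdempotent (dirichletProduct q n H) t‖ ^ p := by
  have hq1 : 1 ≤ q := NeZero.one_le
  have hq1' : (1 : ℝ) ≤ q := by exact_mod_cast hq1
  have hq0 : (0 : ℝ) < q := by linarith
  have hp0 : 0 ≤ p := by linarith
  have hL := shiftConst_pos hq1
  have hG := gridNorm_nonneg p q H
  have hbq : b / q < 1 / 2 := lt_of_le_of_lt (div_le_self hb.le hq1') hb'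
  rw [setIntegral_circleArc _ _ (by positivity) hbq]
  simp only [torusIdempotent_coe]
  rw [intervalIntegral_grid_cell (fun x => ‖expSum (dirichletProduct q n H) x‖ ^ p) hq0,
    mul_inv_cancel_left₀ hq0.ne']
  refine (mul_le_mul_of_nonneg_left (dirichletIntegral_sub_le hp n hb hb'.le)
    (by positivity)).trans ?_
  rw [← intervalIntegral.integral_const_mul]
  have hc := continuous_norm_expSum_rpow hp0 (Finset.range n)
  have hc'' := continuous_norm_expSum_rpow hp0 (dirichletProduct q n H)
  refine intervalIntegral.integral_mono_on (by linarith)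
    ((continuous_const.mul hc).intervalIntegrable _ _)
    ((hc''.comp (by fun_prop : Continuous fun y : ℝ => ((a : ℝ) + y) / q)).intervalIntegrable _ _)
    ?_
  intro y hy
  have hy' : |y| ≤ b := abs_le.2 hy
  simp only [expSum_dirichletProduct_grid hq1 hH, norm_mul]
  rw [← Real.mul_rpow (le_max_left _ _) (norm_nonneg _)]
  refine Real.rpow_le_rpow (by positivity) (mul_le_mul_of_nonneg_right ?_ (norm_nonneg _)) hp0
  refine max_le (norm_nonneg _) ?_
  have h := norm_expSum_shift_sub_le hp.le hH (hy'.trans hb'.le) a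
  have h2 := norm_sub_norm_le (expSum H (a / q)) (expSum H ((a + y) / q))
  rw [norm_sub_rev] at h2
  have h3 : shiftConst q * |y| * gridNorm p q H ≤ shiftConst q * b * gridNorm p q H := by gcongr
  linarith

lemma exists_grid_of_mem_circleArc {q : ℕ} (hq : 1 ≤ q) {c b : ℝ} {t : UnitAddCircle}
    (ht : t ∈ circleArc (c / q) (b / q)) :
    ∃ y : ℝ, |y| ≤ b ∧ t = (((c + y) / q : ℝ) : UnitAddCircle) := by
  have hq0 : (0 : ℝ) < q := by exact_mod_cast hq
  induction t using QuotientAddGroup.induction_on with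
  | H x =>
    replace ht : ‖((x - c / q : ℝ) : UnitAddCircle)‖ ≤ b / q := mem_circleArc.1 ht
    rw [UnitAddCircle.norm_eq] at ht
    refine ⟨q * (x - c / q - round (x - c / q)), ?_, ?_⟩
    · rw [abs_mul, abs_of_pos hq0]
      rwa [le_div_iff₀ hq0, mul_comm] at ht
    · have h : (c + q * (x - c / q - round (x - c / q))) / q = x - round (x - c / q) := by
        field_simp
        ring
      rw [h, AddCircle.coe_sub]
      have h0 : (((round (x - c / q) : ℤ) : ℝ) : UnitAddCircle) = 0 := by
        rw [AddCircle.coe_eq_zero_iff]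
        exact ⟨round (x - c / q), by simp⟩
      rw [h0, sub_zero]

/-- A crude sup bound suffices here: it is only used on the part of the arc outside `E`, whose
relative measure tends to zero. -/
lemma norm_dirichletProduct_le {p : ℝ} (hp : 1 ≤ p) {q : ℕ} [NeZero q] (n : ℕ)
    {H : Finset ℕ} (hH : H ⊆ Finset.range q) {a : ℕ} {b : ℝ} (hb' : b ≤ 1 / 2)
    {t : UnitAddCircle}
    (ht : t ∈ circleArc (a / q) (b / q)) :
    ‖torusIdempotent (dirichletProduct q n H) t‖
      ≤ n * ((1 + shiftConst q * b) * gridNorm p q H) := by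
  have hq1 : 1 ≤ q := NeZero.one_le
  have hp0 : 0 < p := by linarith
  have hL := shiftConst_pos hq1
  have hG := gridNorm_nonneg p q H
  obtain ⟨y, hy, rfl⟩ := exists_grid_of_mem_circleArc hq1 ht
  rw [torusIdempotent_coe, expSum_dirichletProduct_grid hq1 hH, norm_mul, mul_comm]
  have h1 := norm_expSum_le_card (Finset.range n) y
  rw [Finset.card_range] at h1
  refine mul_le_mul h1 ?_ (norm_nonneg _) (by positivity)
  have h2 := norm_expSum_shift_sub_le hp hH (hy.trans hb') a
  have h3 : ‖expSum H (a / q)‖ ≤ gridNorm p q H := by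
    have h := Finset.sum_le_sum_of_subset_of_nonneg (f := fun k : ZMod q =>
      ‖gridValue q H 0 k‖ ^ p) (Finset.subset_univ {(a : ZMod q)})
      (fun _ _ _ => by positivity)
    rw [Finset.sum_singleton, sum_zmod_eq_sum_range] at h
    simp only [gridValue_natCast, add_zero] at h
    have h2 := Real.rpow_le_rpow (by positivity) h (by positivity : 0 ≤ 1 / p)
    rwa [← Real.rpow_mul (norm_nonneg _), mul_one_div_cancel hp0.ne', Real.rpow_one] at h2
  have h4 := norm_sub_norm_le (expSum H ((a + y) / q)) (expSum H (a / q))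
  have h5 : shiftConst q * |y| * gridNorm p q H ≤ shiftConst q * b * gridNorm p q H := by gcongr
  linarith

/-- `E ∩ J` and its reflection are disjoint subsets of `E` carrying the same integral. This is the
source of the factor `2` in the definition of the cyclic level. -/
lemma two_mul_setIntegral_le_of_symmetric {F : UnitAddCircle → ℝ} (hF : Integrable F)
    (hF0 : ∀ t, 0 ≤ F t) (hFneg : ∀ t, F (-t) = F t) {E J : Set UnitAddCircle}
    (hE : NullMeasurableSet E) (hsymm : ∀ t ∈ E, -t ∈ E) (hJ : MeasurableSet J)
    (hdisj : ∀ t ∈ J, -t ∉ J) :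
    2 * ∫ t in E ∩ J, F t ≤ ∫ t in E, F t := by
  have hneg : ∫ t in E ∩ Neg.neg ⁻¹' J, F t = ∫ t in E ∩ J, F t := by
    have hmp : MeasurePreserving (Neg.neg : UnitAddCircle → UnitAddCircle) volume volume :=
      Measure.measurePreserving_neg volume
    have h := hmp.setIntegral_preimage_emb (MeasurableEquiv.neg UnitAddCircle).measurableEmbedding
      F (E ∩ J)
    simp only [hFneg] at h
    have hE' : Neg.neg ⁻¹' E = E := by
      ext t
      exact ⟨fun ht => neg_neg t ▸ hsymm _ ht, hsymm t⟩
    rw [Set.preimage_inter, hE'] at h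
    exact h
  have hd : Disjoint (E ∩ J) (E ∩ Neg.neg ⁻¹' J) :=
    Set.disjoint_left.2 fun t ht ht' => hdisj t ht.2 ht'.2
  have hJ' : MeasurableSet (Neg.neg ⁻¹' J : Set UnitAddCircle) := measurable_neg hJ
  have hu := setIntegral_union₀ (μ := volume) (f := F) hd.aedisjoint
    (hE.inter hJ'.nullMeasurableSet) hF.integrableOn hF.integrableOn
  rw [hneg] at hu
  have hmono : ∫ t in (E ∩ J) ∪ (E ∩ Neg.neg ⁻¹' J), F t ≤ ∫ t in E, F t :=
    setIntegral_mono_set hF.integrableOn (Filter.Eventually.of_forall hF0)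
      (Filter.Eventually.of_forall
        (Set.union_subset Set.inter_subset_left Set.inter_subset_left))
  linarith

lemma le_integral_dirichletProduct {p : ℝ} (hp : 1 < p) {q : ℕ} [NeZero q] (n : ℕ)
    {H : Finset ℕ} (hH : H ⊆ Finset.range q) {a : ℕ} {b : ℝ} (hb : 0 < b) (hb' : b < 1 / 2)
    {E : Set UnitAddCircle} (hE : NullMeasurableSet E) (hsymm : ∀ t ∈ E, -t ∈ E)
    (hdisj : ∀ t ∈ circleArc (a / q) (b / q),
      -t ∉ circleArc (a / q) (b / q)) :
    2 * ((max 0 (‖expSum H (a / q)‖ - shiftConst q * b * gridNorm p q H)) ^ p *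
        (dirichletIntegral p n - 2 * (b ^ (1 - p) / (p - 1))) -
      (n * ((1 + shiftConst q * b) * gridNorm p q H)) ^ p *
        (q * volume.real (circleArc (a / q) (b / q) \ E)))
      ≤ q * ∫ t in E, ‖torusIdempotent (dirichletProduct q n H) t‖ ^ p := by
  have hp0 : 0 ≤ p := by linarith
  set J := circleArc (a / q) (b / q) with hJdef
  set F : UnitAddCircle → ℝ := fun t => ‖torusIdempotent (dirichletProduct q n H) t‖ ^ p
  have hF : Integrable F := integrable_norm_torusIdempotent_rpow hp0 _
  have hJ : MeasurableSet J := measurableSet_circleArc _ _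
  have h1 := two_mul_setIntegral_le_of_symmetric hF (fun _ => by positivity)
    (fun t => by simp only [F, norm_torusIdempotent_neg]) hE hsymm hJ hdisj
  have h2 := le_integral_circleArc_dirichletProduct hp n hH a hb hb'
  have h3 : ∫ t in J, F t = (∫ t in E ∩ J, F t) + ∫ t in J \ E, F t := by
    rw [← integral_inter_add_sdiff₀ hE hF.integrableOn, Set.inter_comm]
  have h4 : ∫ t in J \ E, F t ≤
      (n * ((1 + shiftConst q * b) * gridNorm p q H)) ^ p * volume.real (J \ E) := by
    have hm : NullMeasurableSet (J \ E) := hJ.nullMeasurableSet.diff hE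
    have h := norm_setIntegral_le_of_norm_le_const (μ := volume) (s := J \ E) (f := F)
      (C := (n * ((1 + shiftConst q * b) * gridNorm p q H)) ^ p) (measure_lt_top _ _)
      (fun t ht => by
        rw [Real.norm_of_nonneg (by positivity)]
        exact Real.rpow_le_rpow (norm_nonneg _) (norm_dirichletProduct_le hp.le n hH hb'.le ht.1) hp0)
    exact (Real.le_norm_self _).trans h
  have hq0 : (0 : ℝ) ≤ q := by positivity
  have h5 := mul_le_mul_of_nonneg_left h4 hq0
  have h6 := mul_le_mul_of_nonneg_left h1 hq0
  rw [h3] at h2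
  linarith

/-- Dilating an idempotent on `ℤ/q` by a unit. -/
lemma exists_dilation {q : ℕ} [NeZero q] {H : Finset ℕ} (hH : H ⊆ Finset.range q)
    (hne : H.Nonempty) {a : ℕ} (ha : a.Coprime q) :
    ∃ H' : Finset ℕ, H' ⊆ Finset.range q ∧ H'.Nonempty ∧
      expSum H' (a / q) = expSum H ((1 : ℕ) / q) ∧
      ∀ p, gridNorm p q H' = gridNorm p q H := by
  -- Multiplying the frequencies by `a⁻¹` carries the value at `1` to the point `a` and merely
  -- permutes the values on the grid.
  let u : (ZMod q)ˣ := ZMod.unitOfCoprime a ha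
  let φ : ℕ → ℕ := fun h => ((h : ZMod q) * (u⁻¹ : (ZMod q)ˣ)).val
  have hφ : ∀ h, ((φ h : ℕ) : ZMod q) = (h : ZMod q) * (u⁻¹ : (ZMod q)ˣ) :=
    fun h => ZMod.natCast_zmod_val _
  have hinj : Set.InjOn φ H := by
    intro h hh h' hh' e
    have e' : (h : ZMod q) * (u⁻¹ : (ZMod q)ˣ) = h' * (u⁻¹ : (ZMod q)ˣ) := by
      rw [← hφ, ← hφ, e]
    exact (zmod_natCast_inj_of_lt (Finset.mem_range.1 (hH hh)) (Finset.mem_range.1 (hH hh'))).1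
      ((Units.mul_left_inj _).1 e')
  have key : ∀ k : ZMod q, gridValue q (H.image φ) 0 k
      = gridValue q H 0 ((u⁻¹ : (ZMod q)ˣ) * k) := by
    intro k
    rw [gridValue, Finset.sum_image hinj, gridValue]
    refine Finset.sum_congr rfl fun h _ => ?_
    rw [hφ, mul_zero, mul_zero, mul_assoc]
  refine ⟨H.image φ, ?_, hne.image _, ?_, fun p => ?_⟩
  · intro x hx
    obtain ⟨h, -, rfl⟩ := Finset.mem_image.1 hx
    exact Finset.mem_range.2 (ZMod.val_lt _)
  · have h1 := gridValue_natCast q (H.image φ) 0 a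
    have h2 := gridValue_natCast q H 0 1
    rw [add_zero] at h1 h2
    rw [← h1, ← h2, key]
    congr 1
    rw [Nat.cast_one, Units.inv_mul_eq_iff_eq_mul, mul_one]
    rfl
  · rw [gridNorm, gridNorm]
    congr 1
    have h : ∀ K : Finset ℕ, ∑ k ∈ Finset.range q, ‖expSum K (k / q)‖ ^ p
        = ∑ k : ZMod q, ‖gridValue q K 0 k‖ ^ p := by
      intro K
      rw [sum_zmod_eq_sum_range]
      simp only [gridValue_natCast, add_zero]
    rw [h, h]
    simp only [key]
    exact Fintype.sum_equiv (Units.mulLeft u⁻¹) _ _ fun k => rfl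

/-! ### Parseval's identity and primes approximating almost every point -/

lemma integral_fourier_mul_fourier (m n : ℤ) :
    ∫ t : UnitAddCircle, fourier (-m) t * fourier n t = if m = n then 1 else 0 := by
  have h := congrFun (fourierCoeff_fourier (T := 1) n) m
  rw [fourierCoeff] at h
  have hv : (volume : Measure UnitAddCircle) = AddCircle.haarAddCircle := by
    rw [AddCircle.volume_eq_smul_haarAddCircle]; simp
  rw [hv]
  simp only [smul_eq_mul] at h
  rw [h, Pi.single_apply]

lemma integral_norm_sum_fourier_sq {ι : Type*} (s : Finset ι) (φ : ι → ℤ) (hφ : Set.InjOn φ s)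
    (c : ι → ℂ) :
    ∫ t : UnitAddCircle, ‖∑ i ∈ s, c i * fourier (φ i) t‖ ^ 2 = ∑ i ∈ s, ‖c i‖ ^ 2 := by
  classical
  have key : ∀ t : UnitAddCircle, ((‖∑ i ∈ s, c i * fourier (φ i) t‖ ^ 2 : ℝ) : ℂ)
      = ∑ i ∈ s, ∑ j ∈ s, starRingEnd ℂ (c i) * c j * (fourier (-φ i) t * fourier (φ j) t) := by
    intro t
    rw [Complex.ofReal_pow, ← Complex.conj_mul', map_sum, Finset.sum_mul_sum]
    refine Finset.sum_congr rfl fun i _ => Finset.sum_congr rfl fun j _ => ?_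
    rw [map_mul, fourier_neg]
    ring
  have hint : ∀ i j, Integrable (fun t : UnitAddCircle =>
      starRingEnd ℂ (c i) * c j * (fourier (-φ i) t * fourier (φ j) t)) := by
    intro i j
    exact (by fun_prop : Continuous fun t : UnitAddCircle => starRingEnd ℂ (c i) * c j *
      (fourier (-φ i) t * fourier (φ j) t)).integrable_of_hasCompactSupport
      (HasCompactSupport.of_compactSpace _)
  have h : ((∫ t : UnitAddCircle, ‖∑ i ∈ s, c i * fourier (φ i) t‖ ^ 2 : ℝ) : ℂ)
      = ((∑ i ∈ s, ‖c i‖ ^ 2 : ℝ) : ℂ) := by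
    rw [← integral_complex_ofReal]
    simp only [key]
    rw [integral_finsetSum _ fun i _ => integrable_finsetSum _ fun j _ => hint i j]
    push_cast
    refine Finset.sum_congr rfl fun i hi => ?_
    rw [integral_finsetSum _ fun j _ => hint i j]
    simp only [integral_const_mul, integral_fourier_mul_fourier]
    rw [Finset.sum_eq_single i]
    · rw [if_pos rfl, mul_one, Complex.conj_mul']
    · intro j hj hji
      rw [if_neg fun e => hji (hφ hi hj e).symm, mul_zero]
    · exact fun h => absurd hi h
  exact_mod_cast h

lemma norm_torusIdempotent_range_mul_le (n : ℕ) (t : UnitAddCircle) :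
    ‖torusIdempotent (Finset.range n) t‖ * (2 * ‖t‖) ≤ 1 := by
  induction t using QuotientAddGroup.induction_on with
  | H x =>
    have h0 : ((x - round x : ℝ) : UnitAddCircle) = (x : UnitAddCircle) := by
      have : (((round x : ℤ) : ℝ) : UnitAddCircle) = 0 := by
        rw [AddCircle.coe_eq_zero_iff]
        exact ⟨round x, by simp⟩
      rw [AddCircle.coe_sub, this, sub_zero]
    have h := norm_expSum_range_mul_le n (abs_sub_round x)
    rw [← torusIdempotent_coe, h0, ← UnitAddCircle.norm_eq] at h
    exact h

lemma fourier_nsmul (n : ℤ) (q : ℕ) (t : UnitAddCircle) :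
    fourier n (q • t) = fourier (q * n) t := by
  rw [fourier_apply, fourier_apply, mul_comm, mul_smul, natCast_zsmul]

/-- The number of representations of `d` as a difference of two elements of `{0, …, N-1}`. -/
def diffCount (N : ℕ) (d : ℤ) : ℕ :=
  ((Finset.range N ×ˢ Finset.range N).filter fun x => (x.1 : ℤ) - x.2 = d).card

lemma diffCount_le (N : ℕ) (d : ℤ) : diffCount N d ≤ N := by
  conv_rhs => rw [← Finset.card_range N]
  refine Finset.card_le_card_of_injOn (fun x => x.1) ?_ ?_
  · intro x hx
    exact (Finset.mem_product.1 (Finset.mem_filter.1 hx).1).1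
  · rintro ⟨a, b⟩ hx ⟨a', b'⟩ hx' h
    have h1 := (Finset.mem_filter.1 hx).2
    have h2 := (Finset.mem_filter.1 hx').2
    simp only at h h1 h2
    subst h
    simp only [Prod.mk.injEq, true_and]
    omega

lemma diffCount_zero (N : ℕ) : diffCount N 0 = N := by
  refine le_antisymm (diffCount_le N 0) ?_
  conv_lhs => rw [← Finset.card_range N]
  refine Finset.card_le_card_of_injOn (fun a => (a, a)) ?_ ?_
  · intro a ha
    simpa using ha
  · intro a _ b _ h
    exact (Prod.mk.inj h).1

/-- The nonzero differences of two elements of `{0, …, N-1}`. -/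
noncomputable def diffSet (N : ℕ) : Finset ℤ := (Finset.Ioo (-(N : ℤ)) N).erase 0

/-- Fejér expansion with the mean `N` separated from the nonzero frequencies, which alone enter the
second moment. -/
lemma norm_torusIdempotent_range_sq (N : ℕ) (t : UnitAddCircle) :
    ((‖torusIdempotent (Finset.range N) t‖ ^ 2 : ℝ) : ℂ)
      = N + ∑ d ∈ diffSet N, (diffCount N d : ℂ) * fourier d t := by
  rcases Nat.eq_zero_or_pos N with rfl | hN
  · simp [torusIdempotent, diffSet]
  have h1 : ((‖torusIdempotent (Finset.range N) t‖ ^ 2 : ℝ) : ℂ)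
      = ∑ x ∈ Finset.range N ×ˢ Finset.range N, fourier ((x.1 : ℤ) - x.2) t := by
    rw [Complex.ofReal_pow, ← Complex.mul_conj', torusIdempotent, map_sum, Finset.sum_mul_sum,
      Finset.sum_product]
    refine Finset.sum_congr rfl fun i _ => Finset.sum_congr rfl fun j _ => ?_
    rw [← fourier_neg, ← fourier_add, sub_eq_add_neg]
  have hmaps : ∀ x ∈ Finset.range N ×ˢ Finset.range N,
      (x.1 : ℤ) - x.2 ∈ Finset.Ioo (-(N : ℤ)) N := by
    intro x hx
    have := Finset.mem_product.1 hx
    have h2 := Finset.mem_range.1 this.1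
    have h3 := Finset.mem_range.1 this.2
    rw [Finset.mem_Ioo]
    omega
  rw [h1, ← Finset.sum_fiberwise_of_maps_to hmaps]
  have h2 : ∀ d ∈ Finset.Ioo (-(N : ℤ)) N,
      ∑ x ∈ (Finset.range N ×ˢ Finset.range N).filter (fun x => (x.1 : ℤ) - x.2 = d),
        fourier ((x.1 : ℤ) - x.2) t = (diffCount N d : ℂ) * fourier d t := by
    intro d _
    rw [Finset.sum_congr rfl fun x hx => by rw [(Finset.mem_filter.1 hx).2], Finset.sum_const,
      nsmul_eq_mul, diffCount]
  rw [Finset.sum_congr rfl h2, diffSet, ← Finset.add_sum_erase _ _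
    (Finset.mem_Ioo.2 ⟨by omega, by omega⟩ : (0 : ℤ) ∈ Finset.Ioo (-(N : ℤ)) N), diffCount_zero,
    fourier_zero, mul_one]

/-- The frequencies `qd` with `q ∈ P` and `0 < |d| < N` are pairwise distinct: if `qd = q'd'` with
`q ≠ q'`, the prime `q > N` would divide `d'`. Parseval therefore makes the variances add up, each
being at most `2N · N²`. -/
lemma integral_sum_norm_torusIdempotent_range_sq_sub_le (N : ℕ) (P : Finset ℕ)
    (hP : ∀ q ∈ P, q.Prime ∧ N < q) :
    ∫ t : UnitAddCircle,
      (∑ q ∈ P, (‖torusIdempotent (Finset.range N) (q • t)‖ ^ 2 - N)) ^ 2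
      ≤ P.card * (2 * N ^ 3) := by
  have hinj : Set.InjOn (fun x : ℕ × ℤ => (x.1 : ℤ) * x.2) (P ×ˢ diffSet N : Finset (ℕ × ℤ)) := by
    rintro ⟨q, d⟩ hx ⟨q', d'⟩ hx' h
    obtain ⟨hq, hd⟩ := Finset.mem_product.1 hx
    obtain ⟨hq', hd'⟩ := Finset.mem_product.1 hx'
    simp only [diffSet, Finset.mem_erase, Finset.mem_Ioo] at hq hd hq' hd' h
    have hqq : q = q' := by
      by_contra hne
      have hco : IsCoprime (q : ℤ) q' :=
        Nat.isCoprime_iff_coprime.2 ((Nat.coprime_primes (hP q hq).1 (hP q' hq').1).2 hne)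
      have hdvd : (q : ℤ) ∣ d' := hco.dvd_of_dvd_mul_left ⟨d, h.symm⟩
      have := (hP q hq).2
      exact hd'.1 (Int.eq_zero_of_abs_lt_dvd hdvd (abs_lt.2 ⟨by omega, by omega⟩))
    subst hqq
    have hq0 : (q : ℤ) ≠ 0 := by exact_mod_cast (hP q hq).1.ne_zero
    rw [mul_left_cancel₀ hq0 h]
  have h := integral_norm_sum_fourier_sq _ _ hinj fun x => (diffCount N x.2 : ℂ)
  have key : ∀ t : UnitAddCircle,
      (∑ q ∈ P, (‖torusIdempotent (Finset.range N) (q • t)‖ ^ 2 - N)) ^ 2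
      = ‖∑ x ∈ P ×ˢ diffSet N, (diffCount N x.2 : ℂ) * fourier ((x.1 : ℤ) * x.2) t‖ ^ 2 := by
    intro t
    have h1 : ((∑ q ∈ P, (‖torusIdempotent (Finset.range N) (q • t)‖ ^ 2 - N) : ℝ) : ℂ)
        = ∑ x ∈ P ×ˢ diffSet N, (diffCount N x.2 : ℂ) * fourier ((x.1 : ℤ) * x.2) t := by
      rw [Finset.sum_product, Complex.ofReal_sum]
      refine Finset.sum_congr rfl fun q _ => ?_
      rw [Complex.ofReal_sub, norm_torusIdempotent_range_sq, Complex.ofReal_natCast,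
        add_sub_cancel_left]
      simp only [fourier_nsmul]
    rw [← h1, Complex.norm_real, Real.norm_eq_abs, sq_abs]
  simp only [key]
  rw [h, Finset.sum_product]
  simp only [Finset.sum_const, nsmul_eq_mul]
  refine mul_le_mul_of_nonneg_left ?_ (by positivity)
  have h2 : ∀ d ∈ diffSet N, ‖(diffCount N d : ℂ)‖ ^ 2 ≤ (N : ℝ) ^ 2 := by
    intro d _
    rw [Complex.norm_natCast]
    have : (diffCount N d : ℝ) ≤ N := by exact_mod_cast diffCount_le N d
    gcongr
  have h3 := Finset.sum_le_card_nsmul _ _ _ h2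
  rw [nsmul_eq_mul] at h3
  have h4 : ((diffSet N).card : ℝ) ≤ 2 * N := by
    have : (diffSet N).card ≤ 2 * N := by
      refine (Finset.card_le_card (Finset.erase_subset _ _)).trans ?_
      rw [Int.card_Ioo]
      omega
    exact_mod_cast this
  refine h3.trans ?_
  calc ((diffSet N).card : ℝ) * (N : ℝ) ^ 2 ≤ 2 * N * (N : ℝ) ^ 2 := by gcongr
    _ = _ := by ring

/-- The order of the Dirichlet kernel used together with the denominator `q`. -/
def kernelOrder (q : ℕ) : ℕ := Nat.sqrt (Nat.sqrt q)

/-- If `‖qt‖ ≥ 1/k` with `k = kernelOrder q`, then `|D_N(qt)|² ≤ k²/4`, and `k² ≤ √q ≤ N`; this is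
why a fourth root is taken and why `q ≤ N²`. Each summand of the second-moment sum is then at most
`-N/2`, and Chebyshev's inequality gives `2N³|P| / (|P|N/2)² = 8N/|P|`. -/
lemma volume_real_forall_prime_le {N : ℕ} (hN : 1 ≤ N) (P : Finset ℕ) (hne : P.Nonempty)
    (hP : ∀ q ∈ P, q.Prime ∧ N < q ∧ q ≤ N ^ 2) :
    volume.real {t : UnitAddCircle | ∀ q ∈ P, (kernelOrder q : ℝ)⁻¹ ≤ ‖q • t‖}
      ≤ 8 * N / P.card := by
  have hN0 : (0 : ℝ) < N := by exact_mod_cast hN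
  have hc : (0 : ℝ) < P.card := by exact_mod_cast hne.card_pos
  set g : UnitAddCircle → ℝ := fun t =>
    (∑ q ∈ P, (‖torusIdempotent (Finset.range N) (q • t)‖ ^ 2 - N)) ^ 2 with hg
  have hgc : Continuous g := by
    have := continuous_torusIdempotent (Finset.range N)
    fun_prop
  have hgi : Integrable g :=
    hgc.integrable_of_hasCompactSupport (HasCompactSupport.of_compactSpace _)
  have hmarkov := mul_meas_ge_le_integral_of_nonneg (μ := volume)
    (Filter.Eventually.of_forall fun t => by positivity) hgi ((P.card * N / 2 : ℝ) ^ 2)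
  have hint := integral_sum_norm_torusIdempotent_range_sq_sub_le N P
    fun q hq => ⟨(hP q hq).1, (hP q hq).2.1⟩
  have hsub : {t : UnitAddCircle | ∀ q ∈ P, (kernelOrder q : ℝ)⁻¹ ≤ ‖q • t‖}
      ⊆ {t | (P.card * N / 2 : ℝ) ^ 2 ≤ g t} := by
    intro t ht
    have h1 : ∀ q ∈ P, ‖torusIdempotent (Finset.range N) (q • t)‖ ^ 2 - N ≤ -(N / 2 : ℝ) := by
      intro q hq
      have hk0 : 0 < kernelOrder q := by
        have := (hP q hq).1.pos
        exact Nat.sqrt_pos.2 (Nat.sqrt_pos.2 this)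
      have hk : (0 : ℝ) < kernelOrder q := by exact_mod_cast hk0
      have hkN : (kernelOrder q : ℝ) ^ 2 ≤ N := by
        have h2 : kernelOrder q ^ 2 ≤ Nat.sqrt q := Nat.sqrt_le' _
        have h3 : Nat.sqrt q ≤ N := by
          have := Nat.sqrt_le_sqrt (hP q hq).2.2
          rwa [Nat.sqrt_eq'] at this
        exact_mod_cast h2.trans h3
      have h4 := norm_torusIdempotent_range_mul_le N (q • t)
      have h5 : (kernelOrder q : ℝ)⁻¹ ≤ ‖q • t‖ := ht q hq
      set D := ‖torusIdempotent (Finset.range N) (q • t)‖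
      have hD : 0 ≤ D := norm_nonneg _
      have h6 : D * (2 * (kernelOrder q : ℝ)⁻¹) ≤ 1 :=
        (mul_le_mul_of_nonneg_left (by linarith) hD).trans h4
      have h7 : 2 * D ≤ kernelOrder q := by
        have := mul_le_mul_of_nonneg_right h6 hk.le
        rw [one_mul] at this
        refine le_trans (le_of_eq ?_) this
        field_simp
      nlinarith
    have h2 := Finset.sum_le_card_nsmul P _ _ h1
    rw [nsmul_eq_mul] at h2
    have h3 : (0 : ℝ) ≤ P.card * N / 2 := by positivity
    simp only [Set.mem_ofPred_eq, hg]
    rw [sq_le_sq, abs_of_nonneg h3, le_abs]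
    right
    linarith
  have hmono : volume.real {t : UnitAddCircle | ∀ q ∈ P, (kernelOrder q : ℝ)⁻¹ ≤ ‖q • t‖}
      ≤ volume.real {t | (P.card * N / 2 : ℝ) ^ 2 ≤ g t} := measureReal_mono hsub
  rw [le_div_iff₀ hc]
  have h1 := hmarkov.trans hint
  have h2 : (P.card * N ^ 2 : ℝ) * (volume.real {t | (P.card * N / 2 : ℝ) ^ 2 ≤ g t} * P.card)
      ≤ (P.card * N ^ 2 : ℝ) * (8 * N) := by
    linear_combination 4 * h1
  have h3 := le_of_mul_le_mul_left h2 (by positivity)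
  exact (mul_le_mul_of_nonneg_right hmono hc.le).trans h3

/-- Chebyshev's lower bound, weakened by `log (N²) ≤ 4√N`. Only growth faster than `N` matters,
since this count has to beat both the primes up to `N` and the numerator `8N` above. -/
lemma mul_sqrt_le_primeCounting_sq {N : ℕ} (hN : 12 ≤ N) :
    (N : ℝ) * √N / 8 ≤ Nat.primeCounting (N ^ 2) := by
  have hN' : (12 : ℝ) ≤ N := by exact_mod_cast hN
  have h := Chebyshev.pi_ge (N ^ 2)
  refine le_trans ?_ h
  push_cast
  have hlogpos : 0 < Real.log ((N : ℝ) ^ 2) := Real.log_pos (by nlinarith)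
  have hs : 0 < √(N : ℝ) := Real.sqrt_pos.2 (by linarith)
  have hss : √(N : ℝ) * √N = N := Real.mul_self_sqrt (by linarith)
  have h1 : Real.log ((N : ℝ) ^ 2) ≤ 4 * √N := by
    have h2 := Real.log_le_sub_one_of_pos hs
    have h3 : (N : ℝ) ^ 2 = √N ^ 4 := by nlinarith
    rw [h3, Real.log_pow]
    push_cast
    linarith
  have h4 : Real.log ((N : ℝ) ^ 2 + 1) ≤ 2 * N := by
    have h5 : Real.log ((N : ℝ) ^ 2 + 1) ≤ Real.log (((N : ℝ) + 1) ^ 2) :=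
      Real.log_le_log (by positivity) (by nlinarith)
    have h6 := Real.log_le_sub_one_of_pos (x := (N : ℝ) + 1) (by linarith)
    rw [Real.log_pow] at h5
    push_cast at h5
    linarith
  rw [le_div_iff₀ hlogpos]
  have h7 := Real.log_two_gt_d9
  have h8 : (N : ℝ) * √N / 8 * Real.log ((N : ℝ) ^ 2) ≤ N * √N / 8 * (4 * √N) := by gcongr
  nlinarith

lemma volume_forall_prime_eq_zero (Q : ℕ) :
    volume {t : UnitAddCircle | ∀ q ≥ Q, q.Prime → (kernelOrder q : ℝ)⁻¹ ≤ ‖q • t‖} = 0 := by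
  rw [← measureReal_eq_zero_iff]
  refine le_antisymm (le_of_forall_pos_le_add fun ε hε => ?_) measureReal_nonneg
  rw [zero_add]
  -- The last bound gives `N√N/8 - N ≥ 8N/ε`, hence `8N/|P| ≤ ε`.
  obtain ⟨N, hN⟩ := exists_nat_ge (max (max (Q : ℝ) 256) ((8 * (1 + 8 / ε)) ^ 2))
  have hNQ : Q ≤ N := by exact_mod_cast (le_max_left _ _).trans ((le_max_left _ _).trans hN)
  have hN16 : (256 : ℝ) ≤ N := (le_max_right _ _).trans ((le_max_left _ _).trans hN)
  have hN16' : 256 ≤ N := by exact_mod_cast hN16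
  have hNε : 8 * (1 + 8 / ε) ≤ √N := Real.le_sqrt_of_sq_le ((le_max_right _ _).trans hN)
  set P : Finset ℕ := (Finset.Ioc N (N ^ 2)).filter Nat.Prime with hPdef
  have hP : ∀ q ∈ P, q.Prime ∧ N < q ∧ q ≤ N ^ 2 := by
    intro q hq
    obtain ⟨h1, h2⟩ := Finset.mem_filter.1 hq
    exact ⟨h2, Finset.mem_Ioc.1 h1⟩
  have hcard : Nat.primeCounting (N ^ 2) ≤ P.card + N := by
    rw [Nat.primeCounting, Nat.primeCounting', Nat.count_eq_card_filter_range]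
    have : (Finset.range (N ^ 2 + 1)).filter Nat.Prime ⊆ P ∪ Finset.Icc 1 N := by
      intro q hq
      obtain ⟨h1, h2⟩ := Finset.mem_filter.1 hq
      have h3 := Finset.mem_range.1 h1
      rw [Finset.mem_union, hPdef, Finset.mem_filter, Finset.mem_Ioc, Finset.mem_Icc]
      have := h2.pos
      by_cases h : N < q
      · exact Or.inl ⟨⟨h, by omega⟩, h2⟩
      · exact Or.inr ⟨this, by omega⟩
    refine (Finset.card_le_card this).trans ((Finset.card_union_le _ _).trans ?_)
    simp
  have hcard' : (N : ℝ) * √N / 8 ≤ P.card + N :=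
    (mul_sqrt_le_primeCounting_sq (by omega)).trans (by exact_mod_cast hcard)
  have hN0 : (0 : ℝ) < N := by linarith
  have hPcard : N * (8 / ε) ≤ P.card := by nlinarith
  have hPpos : (0 : ℝ) < P.card := lt_of_lt_of_le (by positivity) hPcard
  have hne : P.Nonempty := Finset.card_pos.1 (by exact_mod_cast hPpos)
  have hsub : {t : UnitAddCircle | ∀ q ≥ Q, q.Prime → (kernelOrder q : ℝ)⁻¹ ≤ ‖q • t‖}
      ⊆ {t : UnitAddCircle | ∀ q ∈ P, (kernelOrder q : ℝ)⁻¹ ≤ ‖q • t‖} :=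
    fun t ht q hq => ht q (hNQ.trans (hP q hq).2.1.le) (hP q hq).1
  refine (measureReal_mono hsub).trans ((volume_real_forall_prime_le (by omega) P hne hP).trans ?_)
  rw [div_le_iff₀ hPpos]
  have h := mul_le_mul_of_nonneg_left hPcard hε.le
  refine le_trans (le_of_eq ?_) h
  field_simp

lemma ae_frequently_prime_norm_nsmul_lt :
    ∀ᵐ t : UnitAddCircle, ∃ᶠ q : ℕ in Filter.atTop,
      q.Prime ∧ ‖q • t‖ < (kernelOrder q : ℝ)⁻¹ := by
  have h : ∀ᵐ t : UnitAddCircle, ∀ Q : ℕ,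
      ¬ ∀ q ≥ Q, q.Prime → (kernelOrder q : ℝ)⁻¹ ≤ ‖q • t‖ := by
    rw [ae_all_iff]
    intro Q
    rw [ae_iff]
    simpa only [not_not] using volume_forall_prime_eq_zero Q
  filter_upwards [h] with t ht
  rw [Filter.frequently_atTop]
  intro Q
  have := ht Q
  push Not at this
  exact this

open Filter Topology

/-! ### From cyclic groups of prime order to the torus -/

lemma lt_kernelOrder_add_one_pow (q : ℕ) : q < (kernelOrder q + 1) ^ 4 := by
  have h1 := Nat.lt_succ_sqrt' q
  have h2 := Nat.lt_succ_sqrt' (Nat.sqrt q)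
  calc q < (Nat.sqrt q + 1) ^ 2 := h1
    _ ≤ ((kernelOrder q + 1) ^ 2) ^ 2 := Nat.pow_le_pow_left h2 2
    _ = _ := by ring

lemma tendsto_kernelOrder : Tendsto kernelOrder atTop atTop := by
  refine tendsto_atTop.2 fun B => ?_
  filter_upwards [eventually_ge_atTop (B ^ 4)] with q hq
  by_contra hcon
  have h1 := lt_kernelOrder_add_one_pow q
  have h2 : (kernelOrder q + 1) ^ 4 ≤ B ^ 4 := Nat.pow_le_pow_left (by omega) 4
  omega

/-- As `q < (kernelOrder q + 1)^4`, the logarithm of `q` is at most a constant plus `4 log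
(kernelOrder q)`, which loses to every positive power. -/
lemma tendsto_shiftConst_div {s : ℝ} (hs : 0 < s) :
    Tendsto (fun q : ℕ => shiftConst q / (kernelOrder q : ℝ) ^ s) atTop (𝓝 0) := by
  have h1 : Tendsto (fun x : ℝ => 2 * Real.pi * ((2 + 4 * Real.log 2) / x ^ s +
      4 * (Real.log x / x ^ s))) atTop (𝓝 (2 * Real.pi * (0 + 4 * 0))) :=
    (((tendsto_rpow_atTop hs).const_div_atTop _).add
      ((isLittleO_log_rpow_atTop hs).tendsto_div_nhds_zero.const_mul 4)).const_mul _
  rw [mul_zero, add_zero, mul_zero] at h1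
  have h2 := h1.comp (tendsto_natCast_atTop_atTop.comp tendsto_kernelOrder)
  refine tendsto_of_tendsto_of_tendsto_of_le_of_le' tendsto_const_nhds h2 ?_ ?_
  · filter_upwards [eventually_ge_atTop 1] with q hq
    have := shiftConst_pos hq
    positivity
  · filter_upwards [eventually_ge_atTop 1,
      tendsto_kernelOrder.eventually (eventually_ge_atTop 1)] with q hq hk
    have hk' : (1 : ℝ) ≤ kernelOrder q := by exact_mod_cast hk
    have hq' : (1 : ℝ) ≤ q := by exact_mod_cast hq
    have hlog : Real.log q ≤ 4 * (Real.log 2 + Real.log (kernelOrder q)) := by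
      have h3 : (q : ℝ) ≤ (2 * kernelOrder q) ^ 4 := by
        have h4 : (q : ℝ) < ((kernelOrder q : ℝ) + 1) ^ 4 := by
          exact_mod_cast lt_kernelOrder_add_one_pow q
        refine h4.le.trans (pow_le_pow_left₀ (by positivity) (by linarith) 4)
      have h5 := Real.log_le_log (by linarith) h3
      rw [Real.log_pow, Real.log_mul (by norm_num) (by positivity)] at h5
      exact_mod_cast h5
    have hpos : 0 < (kernelOrder q : ℝ) ^ s := by positivity
    simp only [Function.comp_apply, shiftConst]
    have h6 : 2 * Real.pi * (2 + Real.log q) ≤ 2 * Real.pi *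
        (2 + 4 * Real.log 2 + 4 * Real.log (kernelOrder q)) := by
      exact mul_le_mul_of_nonneg_left (by linarith) Real.two_pi_pos.le
    calc _ ≤ 2 * Real.pi * (2 + 4 * Real.log 2 + 4 * Real.log (kernelOrder q)) /
          (kernelOrder q : ℝ) ^ s := by gcongr
      _ = _ := by ring

/-- The limiting inequality behind the comparison of the torus with cyclic groups. -/
lemma eventually_concentration_inequality {p γ γ₁ : ℝ} (hp : 1 < p) (hγ : 0 < γ) (hγ₁ : γ < γ₁) :
    ∃ A η : ℝ, 1 ≤ A ∧ 0 < η ∧ ∀ (l : Filter ℕ) (δ : ℕ → ℝ), l ≤ atTop → Tendsto δ l (𝓝 0) →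
      ∀ᶠ q : ℕ in l,
        0 ≤ dirichletIntegral p (kernelOrder q) -
            2 * ((A / kernelOrder q) ^ (1 - p) / (p - 1)) ∧
        γ * ((1 + η) ^ p * dirichletIntegral p (kernelOrder q) +
            (shiftConst q * (1 + 1 / η)) ^ p) ≤
          2 * ((max 0 ((γ₁ / 2) ^ (1 / p) - shiftConst q * (A / kernelOrder q))) ^ p *
            (dirichletIntegral p (kernelOrder q) -
              2 * ((A / kernelOrder q) ^ (1 - p) / (p - 1))) -
            (kernelOrder q * (1 + shiftConst q * (A / kernelOrder q))) ^ p *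
              (2 * (A / kernelOrder q) * δ q)) := by
  have hp0 : 0 < p := by linarith
  have hp1 : 0 < p - 1 := by linarith
  set c : ℝ := (3 * 2 ^ p)⁻¹ with hc
  have hc0 : 0 < c := by positivity
  -- The midpoint `(γ + γ₁)/2` will separate the two sides: `η` keeps the left one below it, and `A`
  -- then keeps the right one above it.
  obtain ⟨η, hη, hη'⟩ : ∃ η : ℝ, 0 < η ∧ γ * (1 + η) ^ p < (γ + γ₁) / 2 := by
    have hcont : ContinuousAt (fun η : ℝ => γ * (1 + η) ^ p) 0 :=
      (((continuous_const.add continuous_id).rpow_const fun _ => Or.inr hp0.le).const_mul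
        γ).continuousAt
    have h := (hcont.tendsto.mono_left (nhdsWithin_le_nhds (s := Set.Ioi 0))).eventually
      (gt_mem_nhds (show γ * (1 + (0 : ℝ)) ^ p < (γ + γ₁) / 2 by
        rw [add_zero, Real.one_rpow]; linarith))
    obtain ⟨η, h1, h2⟩ := (h.and self_mem_nhdsWithin).exists
    exact ⟨η, h2, h1⟩
  obtain ⟨A, hA, hτ1, hτ2⟩ : ∃ A : ℝ, 1 ≤ A ∧ 2 * (A ^ (1 - p) / (p - 1)) / c < 1 ∧
      (γ + γ₁) / 2 < γ₁ * (1 - 2 * (A ^ (1 - p) / (p - 1)) / c) := by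
    have h0 : Tendsto (fun A : ℝ => 2 * (A ^ (1 - p) / (p - 1)) / c) atTop
        (𝓝 (2 * (0 / (p - 1)) / c)) := by
      have := tendsto_rpow_neg_atTop hp1
      rw [neg_sub] at this
      exact ((this.div_const _).const_mul 2).div_const c
    rw [zero_div, mul_zero, zero_div] at h0
    have h1 : Tendsto (fun A : ℝ => γ₁ * (1 - 2 * (A ^ (1 - p) / (p - 1)) / c)) atTop
        (𝓝 (γ₁ * (1 - 0))) := (h0.const_sub 1).const_mul γ₁
    obtain ⟨A, hA⟩ := ((eventually_ge_atTop (1 : ℝ)).and ((h0.eventually (gt_mem_nhds one_pos)).and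
      (h1.eventually (lt_mem_nhds (show (γ + γ₁) / 2 < γ₁ * (1 - 0) by linarith))))).exists
    exact ⟨A, hA⟩
  set τ : ℝ := 2 * (A ^ (1 - p) / (p - 1)) / c with hτ
  refine ⟨A, η, hA, hη, fun l δ hl hδ => ?_⟩
  set ε : ℕ → ℝ := fun q => shiftConst q * (A / kernelOrder q) with hε
  have hεlim : Tendsto ε l (𝓝 0) := by
    have h := ((tendsto_shiftConst_div one_pos).const_mul A).mono_left hl
    rw [mul_zero] at h
    refine h.congr fun q => ?_
    rw [Real.rpow_one, hε]
    ring
  -- `κ` compares the error `shiftConst q ^ p` with the size `n^(p-1)` of the Dirichlet integral; it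
  -- tends to zero because `p > 1`.
  set κ : ℕ → ℝ := fun q => shiftConst q ^ p / (kernelOrder q : ℝ) ^ (p - 1) with hκ
  have hκlim : Tendsto κ l (𝓝 0) := by
    have h := ((tendsto_shiftConst_div (div_pos hp1 hp0)).rpow_const (p := p)
      (Or.inr hp0.le)).mono_left hl
    rw [Real.zero_rpow hp0.ne'] at h
    refine h.congr' ?_
    filter_upwards [hl (eventually_ge_atTop 1)] with q hq
    rw [Real.div_rpow (shiftConst_pos hq).le (by positivity), ← Real.rpow_mul (by positivity),
      div_mul_cancel₀ _ hp0.ne']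
  have hγ2 : (0 : ℝ) ≤ γ₁ / 2 := by linarith
  -- Relative to the Dirichlet integral, the left side is bounded above by a quantity tending to
  -- `γ(1+η)^p` and the right side below by one tending to `γ₁(1-τ)`.
  have hleft : Tendsto (fun q => γ * ((1 + η) ^ p + (1 + 1 / η) ^ p * κ q / c)) l
      (𝓝 (γ * ((1 + η) ^ p + (1 + 1 / η) ^ p * 0 / c))) :=
    (((hκlim.const_mul _).div_const c).const_add _).const_mul γ
  rw [mul_zero, zero_div, add_zero] at hleft
  have hright : Tendsto (fun q => 2 * ((max 0 ((γ₁ / 2) ^ (1 / p) - ε q)) ^ p * (1 - τ) -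
      (1 + ε q) ^ p * (2 * A * |δ q| / c))) l
      (𝓝 (2 * ((max 0 ((γ₁ / 2) ^ (1 / p) - 0)) ^ p * (1 - τ) -
      (1 + 0) ^ p * (2 * A * |0| / c)))) := by
    refine Tendsto.const_mul 2 (Tendsto.sub ?_ ?_)
    · exact ((tendsto_const_nhds.max (hεlim.const_sub _)).rpow_const (Or.inr hp0.le)).mul_const _
    · exact ((hεlim.const_add 1).rpow_const (Or.inr hp0.le)).mul
        ((hδ.abs.const_mul (2 * A)).div_const c)
  have hlim : 2 * ((max 0 ((γ₁ / 2) ^ (1 / p) - 0)) ^ p * (1 - τ) -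
      (1 + 0) ^ p * (2 * A * |0| / c)) = γ₁ * (1 - τ) := by
    rw [sub_zero, max_eq_right (by positivity), ← Real.rpow_mul hγ2, one_div_mul_cancel hp0.ne',
      Real.rpow_one, abs_zero]
    ring
  rw [hlim] at hright
  filter_upwards [hleft.eventually_lt hright (hη'.trans hτ2), hl (eventually_ge_atTop 1),
    hl (tendsto_kernelOrder.eventually (eventually_ge_atTop 1))] with q hineq hq hk
  have hk' : (1 : ℝ) ≤ kernelOrder q := by exact_mod_cast hk
  have hk0 : (0 : ℝ) < kernelOrder q := by linarith
  have hL := shiftConst_pos hq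
  set n : ℝ := (kernelOrder q : ℝ) with hn
  set I := dirichletIntegral p (kernelOrder q) with hI
  have hIc : n ^ (p - 1) * c ≤ I := le_dirichletIntegral hp hk
  have hnp : 0 < n ^ (p - 1) := by positivity
  have hI0 : 0 < I := lt_of_lt_of_le (by positivity) hIc
  have hIc' : n ^ (p - 1) ≤ I / c := by rwa [le_div_iff₀ hc0]
  have htail : 2 * ((A / n) ^ (1 - p) / (p - 1)) ≤ τ * I := by
    have h1 : (A / n) ^ (1 - p) = A ^ (1 - p) * n ^ (p - 1) := by
      rw [Real.div_rpow (by linarith) hk0.le, div_eq_mul_inv, ← Real.rpow_neg hk0.le, neg_sub]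
    have h2 : 0 ≤ 2 * (A ^ (1 - p) / (p - 1)) := by positivity
    calc 2 * ((A / n) ^ (1 - p) / (p - 1)) = 2 * (A ^ (1 - p) / (p - 1)) * n ^ (p - 1) := by
          rw [h1]; ring
      _ ≤ 2 * (A ^ (1 - p) / (p - 1)) * (I / c) := by gcongr
      _ = τ * I := by rw [hτ]; ring
  have hnp' : n ^ p = n ^ (p - 1) * n := by
    rw [← Real.rpow_add_one hk0.ne', sub_add_cancel]
  have hε0 : 0 ≤ ε q := by rw [hε]; positivity
  have herr : (n * (1 + ε q)) ^ p * (2 * (A / n) * δ q)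
      ≤ (1 + ε q) ^ p * (2 * A * |δ q| / c) * I := by
    rw [Real.mul_rpow hk0.le (by positivity), hnp']
    calc n ^ (p - 1) * n * (1 + ε q) ^ p * (2 * (A / n) * δ q)
        = (1 + ε q) ^ p * (2 * A) * n ^ (p - 1) * δ q := by field_simp
      _ ≤ (1 + ε q) ^ p * (2 * A) * n ^ (p - 1) * |δ q| := by
          gcongr
          exact le_abs_self _
      _ ≤ (1 + ε q) ^ p * (2 * A) * (I / c) * |δ q| := by gcongr
      _ = _ := by ring
  have hκ' : (shiftConst q * (1 + 1 / η)) ^ p ≤ (1 + 1 / η) ^ p * κ q / c * I := by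
    rw [Real.mul_rpow hL.le (by positivity)]
    have h1 : shiftConst q ^ p = κ q * n ^ (p - 1) := (div_mul_cancel₀ _ hnp.ne').symm
    have h2 : 0 ≤ κ q := by rw [hκ]; positivity
    calc shiftConst q ^ p * (1 + 1 / η) ^ p = (1 + 1 / η) ^ p * κ q * n ^ (p - 1) := by
          rw [h1]; ring
      _ ≤ (1 + 1 / η) ^ p * κ q * (I / c) := by gcongr
      _ = _ := by ring
  have hpos : 0 ≤ I - 2 * ((A / n) ^ (1 - p) / (p - 1)) := by nlinarith
  refine ⟨hpos, ?_⟩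
  have hmain := mul_le_mul_of_nonneg_right hineq.le hI0.le
  have hX : 0 ≤ (max 0 ((γ₁ / 2) ^ (1 / p) - ε q)) ^ p := by positivity
  calc γ * ((1 + η) ^ p * I + (shiftConst q * (1 + 1 / η)) ^ p)
      ≤ γ * ((1 + η) ^ p * I + (1 + 1 / η) ^ p * κ q / c * I) := by gcongr
    _ = γ * ((1 + η) ^ p + (1 + 1 / η) ^ p * κ q / c) * I := by ring
    _ ≤ _ := hmain
    _ = 2 * ((max 0 ((γ₁ / 2) ^ (1 / p) - ε q)) ^ p * (I - τ * I) -
        (1 + ε q) ^ p * (2 * A * |δ q| / c) * I) := by ring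
    _ ≤ _ := by
        have h1 := mul_le_mul_of_nonneg_left (sub_le_sub_left htail I) hX
        linarith

lemma exists_nearest_fraction (t : UnitAddCircle) {q : ℕ} (hq : 1 ≤ q) :
    ∃ a : ℕ, a < q ∧ ‖t - ((a / q : ℝ) : UnitAddCircle)‖ ≤ ‖q • t‖ / q := by
  have hq0 : (0 : ℝ) < q := by exact_mod_cast hq
  induction t using QuotientAddGroup.induction_on with
  | H x =>
    set m : ℤ := round (q * x) with hm
    have h1 : ‖q • (x : UnitAddCircle)‖ = |q * x - m| := by
      rw [← AddCircle.coe_nsmul, UnitAddCircle.norm_eq, nsmul_eq_mul]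
    have hq' : (q : ℤ) ≠ 0 := by exact_mod_cast (by omega : q ≠ 0)
    obtain ⟨a, ha⟩ := Int.eq_ofNat_of_zero_le (Int.emod_nonneg m hq')
    have haq : (a : ℤ) < q := ha ▸ Int.emod_lt_of_pos m (by exact_mod_cast hq)
    have hdiv : (m : ℝ) = a + q * (m / q : ℤ) := by
      have := Int.emod_add_mul_ediv m q
      rw [ha] at this
      exact_mod_cast this.symm
    refine ⟨a, by exact_mod_cast haq, ?_⟩
    have h2 : ((x : ℝ) : UnitAddCircle) - ((a / q : ℝ) : UnitAddCircle)
        = ((x - a / q - (m / q : ℤ) : ℝ) : UnitAddCircle) := by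
      have : (((m / q : ℤ) : ℝ) : UnitAddCircle) = 0 := by
        rw [AddCircle.coe_eq_zero_iff]
        exact ⟨m / q, by simp⟩
      rw [AddCircle.coe_sub, AddCircle.coe_sub, this, sub_zero]
    have h3 : x - a / q - ((m / q : ℤ) : ℝ) = (q * x - m) / q := by
      rw [hdiv]; field_simp; ring
    have h4 : ‖((x - a / q - (m / q : ℤ) : ℝ) : UnitAddCircle)‖ ≤ |q * x - m| / q := by
      rw [h3]
      rw [UnitAddCircle.norm_eq]
      refine (round_le _ 0).trans ?_
      rw [Int.cast_zero, sub_zero, abs_div, Nat.abs_cast]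
    calc _ = ‖((x - a / q - (m / q : ℤ) : ℝ) : UnitAddCircle)‖ := congrArg _ h2
      _ ≤ _ := h4
      _ = _ := by rw [← h1]

/-- A common point of the arc and its reflection would give an integer `mq - 2a` of modulus less
than `1`, so `q ∣ 2a`, which is impossible for an odd prime `q` and `0 < a < q`. -/
lemma neg_notMem_circleArc {q a : ℕ} (hq : q.Prime) (hq2 : q ≠ 2) (ha : 0 < a) (haq : a < q)
    {b : ℝ} (hb : b < 1 / 2) {t : UnitAddCircle} (ht : t ∈ circleArc (a / q) (b / q)) :
    -t ∉ circleArc (a / q) (b / q) := by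
  intro ht'
  have hq0 : (0 : ℝ) < q := by exact_mod_cast hq.pos
  obtain ⟨y, hy, rfl⟩ := exists_grid_of_mem_circleArc hq.one_le ht
  obtain ⟨z, hz, hyz⟩ := exists_grid_of_mem_circleArc hq.one_le ht'
  have h : ((((a : ℝ) + y) / q + (a + z) / q : ℝ) : UnitAddCircle) = 0 := by
    rw [AddCircle.coe_add, ← hyz, add_neg_cancel]
  rw [AddCircle.coe_eq_zero_iff] at h
  obtain ⟨m, hm⟩ := h
  rw [zsmul_eq_mul, mul_one] at hm
  have h2 : ((m * q - 2 * a : ℤ) : ℝ) = y + z := by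
    push_cast
    rw [hm]
    field_simp
    ring
  have h3 : |((m * q - 2 * a : ℤ) : ℝ)| < 1 := by
    rw [h2]
    exact (abs_add_le _ _).trans_lt (by linarith)
  have h4 : m * q - 2 * a = 0 := by
    rw [← Int.cast_abs] at h3
    exact Int.abs_lt_one_iff.1 (by exact_mod_cast h3)
  have h5 : q ∣ 2 * a := by
    have : (q : ℤ) ∣ ((2 * a : ℕ) : ℤ) := ⟨m, by push_cast; linarith⟩
    exact_mod_cast this
  rcases (hq.dvd_mul).1 h5 with h6 | h6
  · exact hq2 ((Nat.prime_dvd_prime_iff_eq hq Nat.prime_two).1 h6)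
  · exact absurd (Nat.le_of_dvd ha h6) (by omega)

lemma gridNorm_pos {p : ℝ} {q : ℕ} (hq : 1 ≤ q) {H : Finset ℕ} (hH : H.Nonempty) :
    0 < gridNorm p q H := by
  refine Real.rpow_pos_of_pos (Finset.sum_pos' (fun _ _ => by positivity)
    ⟨0, Finset.mem_range.2 (by omega), ?_⟩) _
  rw [Nat.cast_zero, zero_div, expSum_zero, Complex.norm_natCast]
  exact Real.rpow_pos_of_pos (by exact_mod_cast hH.card_pos) _

lemma exists_idempotent_of_lt_cyclicLevelAt {p γ : ℝ} (hp : 0 < p) {q : ℕ} (hγ : γ < cyclicLevelAt p q)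
    (hγ0 : 0 ≤ γ) :
    ∃ H : Finset ℕ, H ⊆ Finset.range q ∧ H.Nonempty ∧
      (γ / 2) ^ (1 / p) * gridNorm p q H ≤ ‖expSum H ((1 : ℕ) / q)‖ := by
  have hne : {γ : ℝ | ∃ H : Finset ℕ, H ⊆ Finset.range q ∧ H.Nonempty ∧
      γ * ∑ k ∈ Finset.range q, ‖cyclicIdempotent q H k‖ ^ p
        ≤ 2 * ‖cyclicIdempotent q H 1‖ ^ p}.Nonempty := by
    -- An empty set would have `sSup ∅ = 0`, against `0 ≤ γ < cyclicLevelAt p q`.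
    by_contra hcon
    rw [Set.not_nonempty_iff_eq_empty] at hcon
    rw [cyclicLevelAt, hcon, Real.sSup_empty] at hγ
    linarith
  obtain ⟨γ', ⟨H, hH, hHne, hineq⟩, hγ'⟩ := exists_lt_of_lt_csSup hne hγ
  refine ⟨H, hH, hHne, ?_⟩
  simp only [cyclicIdempotent_eq] at hineq
  rw [← gridNorm_rpow hp] at hineq
  have hG := gridNorm_nonneg p q H
  have hGp : 0 ≤ gridNorm p q H ^ p := by positivity
  have h1 : γ / 2 * gridNorm p q H ^ p ≤ ‖expSum H ((1 : ℕ) / q)‖ ^ p := by nlinarith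
  have h2 := Real.rpow_le_rpow (by positivity) h1 (by positivity : 0 ≤ 1 / p)
  rwa [Real.mul_rpow (by positivity) hGp, ← Real.rpow_mul hG, ← Real.rpow_mul (norm_nonneg _),
    mul_one_div_cancel hp.ne', Real.rpow_one, Real.rpow_one] at h2

lemma volume_real_circleArc {c r : ℝ} (hr : 0 ≤ r) (hr' : r ≤ 1 / 2) :
    volume.real (circleArc c r) = 2 * r := by
  rw [circleArc, Measure.real, AddCircle.volume_closedBall, min_eq_right (by linarith),
    ENNReal.toReal_ofReal (by linarith)]

lemma isTorusConcentrationConstant_of_eventually_lt {p γ γ₁ : ℝ} (hp : 1 < p) (hγ : 0 < γ)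
    (hγ₁ : γ < γ₁) (hev : ∀ᶠ q in atTop ⊓ 𝓟 {q : ℕ | q.Prime}, γ₁ < cyclicLevelAt p q) :
    IsTorusConcentrationConstant p γ := by
  intro E hE hsymm hEpos
  have hp0 : 0 < p := by linarith
  obtain ⟨A, η, hA, hη, hAη⟩ := eventually_concentration_inequality hp hγ hγ₁
  have hne : (ae (volume.restrict E)).NeBot := by
    rw [ae_neBot, Ne, Measure.restrict_eq_zero]
    exact hEpos.ne'
  have hne0 : ∀ᵐ t : UnitAddCircle, t ≠ 0 := by
    rw [ae_iff]
    simp only [not_not, Set.ofPred_eq_eq_singleton]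
    have h := AddCircle.volume_closedBall (T := 1) (x := 0) 0
    simpa using h
  -- The density theorem is used for balls that contain `t` without being centred at it, since the
  -- arcs are centred at the fractions `a/q`.
  obtain ⟨t, ⟨hdens, hfreq⟩, ht0⟩ := (((IsUnifLocDoublingMeasure.ae_tendsto_measure_inter_div
    (volume : Measure UnitAddCircle) E 1).and
    (ae_restrict_of_ae ae_frequently_prime_norm_nsmul_lt)).and (ae_restrict_of_ae hne0)).exists
  set S : Set ℕ := {q | q.Prime ∧ ‖q • t‖ < (kernelOrder q : ℝ)⁻¹} with hS
  set l : Filter ℕ := atTop ⊓ 𝓟 S with hl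
  have hlne : l.NeBot := frequently_mem_iff_neBot.1 hfreq
  have hltop : l ≤ atTop := inf_le_left
  have hlS : ∀ᶠ q in l, q ∈ S := mem_inf_of_right (mem_principal_self S)
  have hlprime : l ≤ atTop ⊓ 𝓟 {q : ℕ | q.Prime} :=
    inf_le_inf_left _ (principal_mono.2 fun q hq => hq.1)
  choose! a haq hanorm using fun (q : ℕ) (hq : 1 ≤ q) => exists_nearest_fraction t hq
  set b : ℕ → ℝ := fun q => A / kernelOrder q with hb
  have hbpos : ∀ᶠ q in l, 0 < b q := by
    filter_upwards [hltop (tendsto_kernelOrder.eventually (eventually_ge_atTop 1))] with q hk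
    have : (1 : ℝ) ≤ kernelOrder q := by exact_mod_cast hk
    rw [hb]; positivity
  have hblim : Tendsto b l (𝓝 0) :=
    (Tendsto.const_div_atTop (tendsto_natCast_atTop_atTop.comp tendsto_kernelOrder) A).mono_left
      hltop
  have hbhalf : ∀ᶠ q in l, b q < 1 / 2 := hblim.eventually (gt_mem_nhds (by norm_num))
  have hball : ∀ᶠ q in l, t ∈ Metric.closedBall ((a q / q : ℝ) : UnitAddCircle)
      (1 * (b q / q)) := by
    filter_upwards [hlS, hltop (eventually_ge_atTop 1)] with q hqS hq
    have hq0 : (0 : ℝ) < q := by exact_mod_cast hq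
    rw [Metric.mem_closedBall, dist_eq_norm, one_mul]
    refine (hanorm q hq).trans ?_
    gcongr
    refine hqS.2.le.trans ?_
    change _ ≤ A / (kernelOrder q : ℝ)
    rw [← one_div]
    gcongr
  have hrlim : Tendsto (fun q => b q / q) l (𝓝[>] 0) := by
    refine tendsto_nhdsWithin_iff.2 ⟨?_, ?_⟩
    · have h := hblim.mul (tendsto_inv_atTop_nhds_zero_nat.mono_left hltop)
      rw [mul_zero] at h
      exact h.congr fun q => (div_eq_mul_inv _ _).symm
    · filter_upwards [hbpos, hltop (eventually_ge_atTop 1)] with q hbq hq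
      have hq0 : (0 : ℝ) < q := by exact_mod_cast hq
      exact div_pos hbq hq0
  have hdens' := hdens (fun q : ℕ => ((a q / q : ℝ) : UnitAddCircle)) (fun q => b q / q) hrlim hball
  set δ : ℕ → ℝ := fun q => 1 - (volume (E ∩ circleArc (a q / q) (b q / q)) /
    volume (circleArc (a q / q) (b q / q))).toReal with hδ
  have hδlim : Tendsto δ l (𝓝 0) := by
    have h := ((ENNReal.tendsto_toReal ENNReal.one_ne_top).comp hdens').const_sub 1
    rw [ENNReal.toReal_one, sub_self] at h
    exact h
  -- If `a q = 0`, then `t` would lie within `b q / q → 0` of `0`. A nonzero `a q` is needed both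
  -- for the dilation and for the disjointness of the arc from its reflection.
  have hanz : ∀ᶠ q in l, 0 < a q := by
    have hpos : 0 < ‖t‖ := norm_pos_iff.2 ht0
    filter_upwards [(hrlim.mono_right nhdsWithin_le_nhds).eventually (gt_mem_nhds hpos),
      hball] with q hlt hmem
    by_contra hcon
    have ha0 : a q = 0 := by omega
    rw [ha0, Metric.mem_closedBall, one_mul, dist_eq_norm, Nat.cast_zero, zero_div] at hmem
    have h0 : ((0 : ℝ) : UnitAddCircle) = 0 := AddCircle.coe_zero _
    rw [h0, sub_zero] at hmem
    exact absurd hlt (not_lt.2 hmem)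
  have hthree : ∀ᶠ q in l, 3 ≤ q := hltop (eventually_ge_atTop 3)
  obtain ⟨q, hqS, hq3, hbq, hbq', haq0, hlevel, hIpos, hineq⟩ :=
    (hlS.and (hthree.and (hbpos.and (hbhalf.and (hanz.and
      ((hev.filter_mono hlprime).and (hAη l δ hltop hδlim))))))).exists
  have hprime : q.Prime := hqS.1
  have hq1 : 1 ≤ q := by have : 3 ≤ q := hq3; omega
  have : NeZero q := ⟨by omega⟩
  have hq0 : (0 : ℝ) < q := by exact_mod_cast hq1
  have hq1' : (1 : ℝ) ≤ q := by exact_mod_cast hq1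
  have hkpos : 1 ≤ kernelOrder q := by
    by_contra hcon
    have h0 : kernelOrder q = 0 := by omega
    simp [hb, h0] at hbq
  obtain ⟨H₀, hH₀, hH₀ne, hpeak₀⟩ := exists_idempotent_of_lt_cyclicLevelAt hp0 hlevel
    (hγ.trans hγ₁).le
  have hcop : (a q).Coprime q :=
    Nat.Coprime.symm ((hprime.coprime_iff_not_dvd).2 fun h =>
      absurd (Nat.le_of_dvd haq0 h) (not_le.2 (haq q hq1)))
  obtain ⟨H, hH, hHne, hpeak, hnorm⟩ := exists_dilation hH₀ hH₀ne hcop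
  rw [← hpeak, ← hnorm p] at hpeak₀
  refine ⟨dirichletProduct q (kernelOrder q) H, dirichletProduct_nonempty hHne hkpos, ?_⟩
  set G := gridNorm p q H with hG
  have hGpos : 0 < G := gridNorm_pos hq1 hHne
  have hupper := integral_dirichletProduct_le hp (kernelOrder q) hH hη
  have hlower := le_integral_dirichletProduct hp (kernelOrder q) hH hbq hbq' hE hsymm
    (fun t ht => neg_notMem_circleArc hprime (by omega) haq0 (haq q hq1) hbq' ht)
  have hmiss : q * volume.real (circleArc (a q / q) (b q / q) \ E) = 2 * b q * δ q := by
    have hvol := volume_real_circleArc (c := a q / q) (r := b q / q) (by positivity)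
      ((div_le_self hbq.le hq1').trans hbq'.le)
    have hsplit := measureReal_inter_add_sdiff₀ (μ := volume) (s := circleArc (a q / q) (b q / q)) hE
    have hδ' : δ q = 1 - volume.real (E ∩ circleArc (a q / q) (b q / q)) /
        volume.real (circleArc (a q / q) (b q / q)) :=
      congrArg (1 - ·) (ENNReal.toReal_div _ _)
    rw [Set.inter_comm, hvol] at hsplit
    rw [hδ', hvol, eq_sub_of_add_eq' hsplit]
    field_simp
  rw [hmiss] at hlower
  set f := dirichletProduct q (kernelOrder q) H with hf
  have hL := shiftConst_pos hq1
  have hn0 : (0 : ℝ) ≤ kernelOrder q := by positivity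
  have hmono : (max 0 ((γ₁ / 2) ^ (1 / p) - shiftConst q * b q)) ^ p * G ^ p
      ≤ (max 0 (‖expSum H (a q / q)‖ - shiftConst q * b q * G)) ^ p := by
    rw [← Real.mul_rpow (le_max_left _ _) hGpos.le]
    refine Real.rpow_le_rpow (by positivity) ?_ hp0.le
    rw [max_mul_of_nonneg _ _ hGpos.le, zero_mul]
    refine max_le_max le_rfl ?_
    rw [sub_mul]
    linarith
  have herr : (kernelOrder q * ((1 + shiftConst q * b q) * G)) ^ p
      = (kernelOrder q * (1 + shiftConst q * b q)) ^ p * G ^ p := by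
    rw [← mul_assoc, Real.mul_rpow (by positivity) hGpos.le]
  rw [herr] at hlower
  have h1 := mul_le_mul_of_nonneg_right hmono hIpos
  have h2 := mul_le_mul_of_nonneg_left hineq (by positivity : 0 ≤ G ^ p)
  have h3 := mul_le_mul_of_nonneg_left hupper hγ.le
  have h4 : q * (γ * ∫ t : UnitAddCircle, ‖torusIdempotent f t‖ ^ p)
      ≤ q * ∫ t in E, ‖torusIdempotent f t‖ ^ p := by
    refine le_trans ?_ hlower
    calc q * (γ * ∫ t : UnitAddCircle, ‖torusIdempotent f t‖ ^ p)
        = γ * (q * ∫ t : UnitAddCircle, ‖torusIdempotent f t‖ ^ p) := by ring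
      _ ≤ _ := h3
      _ = _ := by ring
      _ ≤ _ := h2
      _ ≤ _ := by linarith
  exact le_of_mul_le_mul_left h4 hq0

/-! ### Basic properties of the levels -/

lemma integral_norm_torusIdempotent_rpow_pos {p : ℝ} (hp : 0 ≤ p) {H : Finset ℕ}
    (hH : H.Nonempty) : 0 < ∫ t : UnitAddCircle, ‖torusIdempotent H t‖ ^ p := by
  refine (continuous_norm_torusIdempotent_rpow hp
    H).integral_pos_of_hasCompactSupport_nonneg_nonzero (HasCompactSupport.of_compactSpace _)
    (fun _ => by positivity) (x := 0) ?_
  have h : torusIdempotent H 0 = H.card := by simp [torusIdempotent]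
  rw [h, Complex.norm_natCast]
  have : (0 : ℝ) < H.card := by exact_mod_cast hH.card_pos
  positivity

lemma isTorusConcentrationConstant_zero (p : ℝ) : IsTorusConcentrationConstant p 0 := by
  intro E _ _ _
  refine ⟨{0}, Finset.singleton_nonempty 0, ?_⟩
  rw [zero_mul]
  exact integral_nonneg fun _ => by positivity

lemma bddAbove_torusConcentrationConstant {p : ℝ} (hp : 0 ≤ p) :
    BddAbove {γ : ℝ | IsTorusConcentrationConstant p γ} := by
  refine ⟨1, fun γ hγ => ?_⟩
  obtain ⟨H, hH, hineq⟩ := hγ Set.univ MeasurableSet.univ.nullMeasurableSet (fun _ _ => trivial)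
    (by simp)
  rw [setIntegral_univ] at hineq
  have h := integral_norm_torusIdempotent_rpow_pos hp hH
  exact le_of_mul_le_mul_right (by rwa [one_mul]) h

lemma torusLevel_nonneg {p : ℝ} (hp : 0 ≤ p) : 0 ≤ torusLevel p :=
  le_csSup (bddAbove_torusConcentrationConstant hp) (isTorusConcentrationConstant_zero p)

lemma le_two_of_cyclicIdempotent {p γ : ℝ} {q : ℕ} (hq : 2 ≤ q) {H : Finset ℕ}
    (hH : H.Nonempty)
    (h : γ * ∑ k ∈ Finset.range q, ‖cyclicIdempotent q H k‖ ^ p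
      ≤ 2 * ‖cyclicIdempotent q H 1‖ ^ p) : γ ≤ 2 := by
  have h1 : ‖cyclicIdempotent q H 1‖ ^ p ≤ ∑ k ∈ Finset.range q, ‖cyclicIdempotent q H k‖ ^ p :=
    Finset.single_le_sum (f := fun k => ‖cyclicIdempotent q H k‖ ^ p)
      (fun _ _ => by positivity) (Finset.mem_range.2 hq)
  have h0 : 0 < ∑ k ∈ Finset.range q, ‖cyclicIdempotent q H k‖ ^ p := by
    refine Finset.sum_pos' (fun _ _ => by positivity) ⟨0, Finset.mem_range.2 (by omega), ?_⟩
    rw [cyclicIdempotent_eq, Nat.cast_zero, zero_div, expSum_zero, Complex.norm_natCast]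
    exact Real.rpow_pos_of_pos (by exact_mod_cast hH.card_pos) _
  refine le_of_mul_le_mul_right ?_ h0
  linarith

lemma le_cyclicLevelAt {p γ : ℝ} {q : ℕ} (hq : 2 ≤ q) {H : Finset ℕ} (hH : H ⊆ Finset.range q)
    (hne : H.Nonempty)
    (h : γ * ∑ k ∈ Finset.range q, ‖cyclicIdempotent q H k‖ ^ p
      ≤ 2 * ‖cyclicIdempotent q H 1‖ ^ p) : γ ≤ cyclicLevelAt p q :=
  le_csSup ⟨2, fun _ ⟨_, _, hne', h'⟩ => le_two_of_cyclicIdempotent hq hne' h'⟩ ⟨H, hH, hne, h⟩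

lemma cyclicLevelAt_nonneg (p : ℝ) {q : ℕ} (hq : 2 ≤ q) : 0 ≤ cyclicLevelAt p q := by
  refine le_cyclicLevelAt hq (H := {0}) (by simpa using by omega)
    (Finset.singleton_nonempty 0) ?_
  rw [zero_mul]
  positivity

lemma cyclicLevelAt_le_two (p : ℝ) {q : ℕ} (hq : 2 ≤ q) : cyclicLevelAt p q ≤ 2 :=
  Real.sSup_le (fun _ ⟨_, _, hne, h⟩ => le_two_of_cyclicIdempotent hq hne h) (by norm_num)

lemma isBoundedUnder_ge_cyclicLevelAt (p : ℝ) {l : Filter ℕ} (hl : l ≤ atTop) :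
    l.IsBoundedUnder (· ≥ ·) (cyclicLevelAt p) :=
  isBoundedUnder_of_eventually_ge (a := 0)
    (hl ((eventually_ge_atTop 2).mono fun _ hq => cyclicLevelAt_nonneg p hq))

lemma isCoboundedUnder_ge_cyclicLevelAt (p : ℝ) {l : Filter ℕ} [l.NeBot] (hl : l ≤ atTop) :
    l.IsCoboundedUnder (· ≥ ·) (cyclicLevelAt p) :=
  (isBoundedUnder_of_eventually_le (a := 2)
    (hl ((eventually_ge_atTop 2).mono fun _ hq => cyclicLevelAt_le_two p hq))).isCoboundedUnder_ge

instance neBot_atTop_inf_primes : (atTop ⊓ 𝓟 {q : ℕ | q.Prime}).NeBot :=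
  frequently_mem_iff_neBot.1 (Nat.frequently_atTop_iff_infinite.2 Nat.infinite_setOfPred_prime)

lemma cyclicLevel_le_cyclicPrimeLevel (p : ℝ) : cyclicLevel p ≤ cyclicPrimeLevel p :=
  liminf_le_liminf_of_le inf_le_left (isBoundedUnder_ge_cyclicLevelAt p le_rfl)
    (isCoboundedUnder_ge_cyclicLevelAt p inf_le_left)

lemma cyclicPrimeLevel_le_torusLevel {p : ℝ} (hp : 1 < p) :
    cyclicPrimeLevel p ≤ torusLevel p := by
  have hp0 : 0 ≤ p := by linarith
  refine le_of_forall_lt_imp_le_of_dense fun γ hγ => ?_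
  rcases le_or_gt γ 0 with hγ0 | hγ0
  · exact hγ0.trans (torusLevel_nonneg hp0)
  · obtain ⟨γ₁, h1, h2⟩ := exists_between hγ
    exact le_csSup (bddAbove_torusConcentrationConstant hp0)
      (isTorusConcentrationConstant_of_eventually_lt hp hγ0 h1
        (eventually_lt_of_lt_liminf h2 (isBoundedUnder_ge_cyclicLevelAt p inf_le_left)))

/-! ### The lower bound for the cyclic level at `p = 2` -/

/-- Parseval on `ℤ/q`: the elements of `H` are distinct residues. -/
lemma sum_norm_expSum_grid_sq {q : ℕ} [NeZero q] {H : Finset ℕ} (hH : H ⊆ Finset.range q) :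
    ∑ k ∈ Finset.range q, ‖expSum H (k / q)‖ ^ 2 = q * H.card := by
  have h : ((∑ k ∈ Finset.range q, ‖expSum H (k / q)‖ ^ 2 : ℝ) : ℂ) = q * H.card := by
    have h1 : ∀ k : ZMod q, ((‖gridValue q H 0 k‖ ^ 2 : ℝ) : ℂ)
        = ∑ h ∈ H, ∑ h' ∈ H, ZMod.stdAddChar (k * ((h' : ZMod q) - (h : ZMod q))) := by
      intro k
      simp only [Complex.ofReal_pow, ← Complex.conj_mul', gridValue, mul_zero, zero_div,
        unitExp_zero, one_mul, map_sum, Finset.sum_mul_sum]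
      refine Finset.sum_congr rfl fun h _ => Finset.sum_congr rfl fun h' _ => ?_
      rw [← AddChar.map_neg_eq_conj, ← AddChar.map_add_eq_mul]
      congr 1
      ring
    have h2 : ∑ k ∈ Finset.range q, ‖expSum H (k / q)‖ ^ 2
        = ∑ k : ZMod q, ‖gridValue q H 0 k‖ ^ 2 := by
      rw [sum_zmod_eq_sum_range]
      simp only [gridValue_natCast, add_zero]
    rw [h2, Complex.ofReal_sum, Finset.sum_congr rfl fun k _ => h1 k, Finset.sum_comm]
    have h3 : ∀ h ∈ H, ∑ k : ZMod q, ∑ h' ∈ H,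
        ZMod.stdAddChar (k * ((h' : ZMod q) - (h : ZMod q))) = (q : ℂ) := by
      intro h hh
      rw [Finset.sum_comm]
      rw [Finset.sum_eq_single h]
      · simp
      · intro h' hh' hne
        rw [AddChar.sum_mulShift _ (ZMod.isPrimitive_stdAddChar q), if_neg, Nat.cast_zero]
        rw [sub_eq_zero, zmod_natCast_inj_of_lt (Finset.mem_range.1 (hH hh'))
          (Finset.mem_range.1 (hH hh))]
        exact hne
      · exact fun hcon => absurd hh hcon
    rw [Finset.sum_congr rfl h3, Finset.sum_const, nsmul_eq_mul, mul_comm]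
  exact_mod_cast h

lemma norm_expSum_range_inv_mul_sin {q : ℕ} (hq : 1 ≤ q) {m : ℕ} (hm : m ≤ q) :
    ‖expSum (Finset.range m) ((q : ℝ)⁻¹)‖ * Real.sin (Real.pi * (q : ℝ)⁻¹)
      = Real.sin (Real.pi * (m * (q : ℝ)⁻¹)) := by
  have hq1 : (1 : ℝ) ≤ q := by exact_mod_cast hq
  have hm' : (m : ℝ) ≤ q := by exact_mod_cast hm
  have hq0 : (0 : ℝ) < q := by linarith
  have h := congrArg norm (expSum_range_mul m ((q : ℝ)⁻¹))
  have hnn : ∀ x : ℝ, 0 ≤ x → x ≤ 1 → 0 ≤ Real.sin (Real.pi * x) := fun x h0 h1 =>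
    Real.sin_nonneg_of_nonneg_of_le_pi (by positivity) (by nlinarith [Real.pi_pos])
  have h1 := hnn (q : ℝ)⁻¹ (by positivity) (inv_le_one_of_one_le₀ hq1)
  have h2 := hnn (m * (q : ℝ)⁻¹) (by positivity)
    (by rw [← div_eq_mul_inv]; exact div_le_one_of_le₀ hm' hq0.le)
  rw [norm_mul, norm_unitExp_sub_one, norm_unitExp_sub_one, abs_of_nonneg h1,
    abs_of_nonneg h2] at h
  linarith

lemma sin_pi_mul_inv_pos {q : ℕ} (hq : 2 ≤ q) : 0 < Real.sin (Real.pi * (q : ℝ)⁻¹) := by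
  have hq2 : (2 : ℝ) ≤ q := by exact_mod_cast hq
  have hq0 : (0 : ℝ) < q := by linarith
  refine Real.sin_pos_of_pos_of_lt_pi (by positivity) ?_
  have : (q : ℝ)⁻¹ < 1 := inv_lt_one_of_one_lt₀ (by linarith)
  nlinarith [Real.pi_pos]

lemma tendsto_natCast_mul_sin_pi_mul_inv :
    Tendsto (fun q : ℕ => (q : ℝ) * Real.sin (Real.pi * (q : ℝ)⁻¹)) atTop (𝓝 Real.pi) := by
  have h0 : HasDerivAt (fun y : ℝ => Real.sin (Real.pi * y)) Real.pi 0 := by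
    have := ((hasDerivAt_id (0 : ℝ)).const_mul Real.pi).sin
    simpa using this
  have h1 := h0.tendsto_slope_zero
  have h2 : Tendsto (fun q : ℕ => (q : ℝ)⁻¹) atTop (𝓝[≠] 0) := by
    refine tendsto_nhdsWithin_iff.2 ⟨tendsto_inv_atTop_nhds_zero_nat, ?_⟩
    filter_upwards [eventually_ge_atTop 1] with q hq
    have : (q : ℝ) ≠ 0 := by exact_mod_cast (by omega : q ≠ 0)
    exact inv_ne_zero this
  refine (h1.comp h2).congr fun q => ?_
  simp

/-- The witness is the interval of `m = ⌊xq/π⌋` frequencies. Its value at `1` has modulus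
`sin(πm/q)/sin(π/q)`, its total square sum is `qm`, and the ratio tends to the stated value. -/
lemma le_cyclicLevel_two_of_lt_pi {x : ℝ} (hx : 0 < x) (hxπ : x < Real.pi) :
    2 * Real.sin x ^ 2 / (Real.pi * x) ≤ cyclicLevel 2 := by
  have hπ := Real.pi_pos
  set m : ℕ → ℕ := fun q => ⌊x / Real.pi * (q : ℝ)⌋₊ with hm
  have hlim1 : Tendsto (fun q : ℕ => (m q : ℝ) / q) atTop (𝓝 (x / Real.pi)) :=
    (tendsto_nat_floor_mul_div_atTop (by positivity)).comp tendsto_natCast_atTop_atTop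
  set r : ℕ → ℝ := fun q => 2 * Real.sin (Real.pi * ((m q : ℝ) / q)) ^ 2 /
    ((m q : ℝ) / q * ((q : ℝ) * Real.sin (Real.pi * (q : ℝ)⁻¹)) ^ 2) with hr
  have hrlim : Tendsto r atTop (𝓝 (2 * Real.sin x ^ 2 / (Real.pi * x))) := by
    have h1 := ((((Real.continuous_sin.tendsto _).comp (hlim1.const_mul Real.pi)).pow 2).const_mul
      2).div (hlim1.mul (tendsto_natCast_mul_sin_pi_mul_inv.pow 2)) (by positivity)
    have e1 : Real.pi * (x / Real.pi) = x := by field_simp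
    have e2 : x / Real.pi * Real.pi ^ 2 = Real.pi * x := by field_simp
    rw [e1, e2] at h1
    exact h1
  rw [← hrlim.liminf_eq]
  refine liminf_le_liminf ?_ hrlim.isBoundedUnder_ge
    (isCoboundedUnder_ge_cyclicLevelAt 2 le_rfl)
  have hpos : ∀ᶠ q : ℕ in atTop, 0 < (m q : ℝ) / q :=
    hlim1.eventually (lt_mem_nhds (by positivity))
  filter_upwards [hpos, eventually_ge_atTop 2] with q hmq hq
  have hq0 : (0 : ℝ) < q := by exact_mod_cast (by omega : 0 < q)
  have hneZ : NeZero q := ⟨by omega⟩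
  have hm0 : (0 : ℝ) < m q := by
    have := mul_pos hmq hq0
    rwa [div_mul_cancel₀ _ hq0.ne'] at this
  have hmle : m q ≤ q := by
    refine Nat.floor_le_of_le ?_
    have : x / Real.pi ≤ 1 := (div_le_one hπ).2 hxπ.le
    nlinarith
  have hsub : Finset.range (m q) ⊆ Finset.range q := Finset.range_subset_range.2 hmle
  refine le_cyclicLevelAt hq hsub
    (Finset.nonempty_range_iff.2 (by exact_mod_cast hm0.ne')) ?_
  simp only [cyclicIdempotent_eq, Real.rpow_two]
  rw [sum_norm_expSum_grid_sq hsub, Finset.card_range, Nat.cast_one, one_div]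
  have hs := sin_pi_mul_inv_pos hq
  have hD := norm_expSum_range_inv_mul_sin (by omega : 1 ≤ q) hmle
  rw [← div_eq_mul_inv (m q : ℝ)] at hD
  rw [hr]
  simp only
  rw [← hD]
  generalize Real.sin (Real.pi * (q : ℝ)⁻¹) = s at hs ⊢
  generalize ‖expSum (Finset.range (m q)) ((q : ℝ)⁻¹)‖ = D
  apply le_of_eq
  field_simp

/-- `sin²` is `π`-periodic, so reducing `x` modulo `π` only shrinks the denominator; at multiples of
`π` the quotient vanishes. -/
lemma le_cyclicLevel_two {x : ℝ} (hx : 0 < x) :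
    2 * Real.sin x ^ 2 / (Real.pi * x) ≤ cyclicLevel 2 := by
  have hπ := Real.pi_pos
  have h0 : 0 ≤ cyclicLevel 2 :=
    le_trans (by positivity) (le_cyclicLevel_two_of_lt_pi one_pos (by linarith [Real.pi_gt_three]))
  set k : ℤ := ⌊x / Real.pi⌋ with hk
  set y : ℝ := x - k * Real.pi with hy
  have hk0 : (0 : ℝ) ≤ k := by exact_mod_cast Int.floor_nonneg.2 (by positivity)
  have hy0 : 0 ≤ y := by
    have := Int.floor_le (x / Real.pi)
    rw [le_div_iff₀ hπ] at this
    linarith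
  have hyπ : y < Real.pi := by
    have := Int.lt_floor_add_one (x / Real.pi)
    rw [div_lt_iff₀ hπ] at this
    linarith
  have hsin : Real.sin y ^ 2 = Real.sin x ^ 2 := by
    rw [hy, Real.sin_sub_int_mul_pi, mul_pow, ← zpow_natCast, ← zpow_mul, mul_comm k, zpow_mul]
    simp
  rcases hy0.eq_or_lt with h | h
  · rw [← hsin, ← h, Real.sin_zero]
    simpa using h0
  · refine le_trans ?_ (le_cyclicLevel_two_of_lt_pi h hyπ)
    rw [hsin]
    gcongr
    rw [hy]
    nlinarith

/-! ### The upper bound for the torus level at `p = 2` -/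

/-- Among the sums of `m` distinct `q`-th roots of unity, those over `m` consecutive roots have
the largest modulus. -/
lemma norm_expSum_inv_le {q : ℕ} (hq : 1 ≤ q) {A : Finset ℕ} (hA : A ⊆ Finset.range q) :
    ‖expSum A ((q : ℝ)⁻¹)‖ ≤ ‖expSum (Finset.range A.card) ((q : ℝ)⁻¹)‖ := by
  have hπ := Real.pi_pos
  have hq0 : (0 : ℝ) < q := by exact_mod_cast hq
  have hqz : (0 : ℤ) < q := by exact_mod_cast hq
  set z := expSum A ((q : ℝ)⁻¹) with hz
  set m := A.card with hm
  have hmq : m ≤ q := by simpa using Finset.card_le_card hA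
  have hmq' : (m : ℝ) ≤ q := by exact_mod_cast hmq
  -- Rotating by `e(-c/q)` makes the sum a nonnegative real, so its modulus becomes a sum of cosines
  -- `cos(2π(h-c)/q)`, to be maximised over sets of `m` residues.
  set c : ℝ := q * (z.arg / (2 * Real.pi)) with hc
  set g : ℤ → ℝ := fun h => (unitExp ((h - c) / q)).re with hg
  have hzarg : unitExp (-(c / q)) * z = ‖z‖ := by
    have h1 : c / q = z.arg / (2 * Real.pi) := by rw [hc]; field_simp
    have h2 : unitExp (c / q) = Complex.exp (z.arg * Complex.I) := by
      rw [h1, unitExp]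
      congr 3
      field_simp
    have h3 := Complex.norm_mul_exp_arg_mul_I z
    rw [← h2] at h3
    have h4 : unitExp (-(c / q)) * unitExp (c / q) = 1 := by
      rw [← unitExp_add, neg_add_cancel, unitExp_zero]
    calc unitExp (-(c / q)) * z = unitExp (-(c / q)) * (‖z‖ * unitExp (c / q)) := by rw [h3]
      _ = ‖z‖ * (unitExp (-(c / q)) * unitExp (c / q)) := by ring
      _ = ‖z‖ := by rw [h4, mul_one]
  have hsumA : ‖z‖ = ∑ h ∈ A, g h := by
    have h1 := congrArg Complex.re hzarg
    rw [Complex.ofReal_re] at h1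
    rw [← h1, hz, expSum, Finset.mul_sum, Complex.re_sum]
    refine Finset.sum_congr rfl fun h _ => ?_
    rw [← unitExp_add, hg]
    simp only [Int.cast_natCast]
    congr 2
    field_simp
    ring
  -- The `m` consecutive integers from `h₀` on all lie within `m/2` of `c`, and the next `q - m` lie
  -- at distance at least `m/2` from `c` modulo `q`; `lam` is the cosine at that threshold.
  set h₀ : ℤ := ⌈c - m / 2⌉ with hh₀
  have hh1 : c - m / 2 ≤ h₀ := Int.le_ceil _
  have hh2 : (h₀ : ℝ) < c - m / 2 + 1 := Int.ceil_lt_add_one _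
  set G : ℕ → ℝ := fun i => g (h₀ + i) with hG
  have hGcos : ∀ i : ℕ, G i = Real.cos (2 * Real.pi * ((h₀ + i - c) / q)) := by
    intro i
    simp only [hG, hg, unitExp_re]
    push_cast
    rfl
  set lam : ℝ := Real.cos (2 * Real.pi * ((m / 2) / q)) with hlam
  have hmπ : 2 * Real.pi * ((m / 2 : ℝ) / q) ≤ Real.pi := by
    have : (m / 2 : ℝ) / q ≤ 1 / 2 := by rw [div_le_iff₀ hq0]; linarith
    nlinarith
  have hlow : ∀ i ∈ Finset.range m, lam ≤ G i := by
    intro i hi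
    have hi' : (i : ℝ) + 1 ≤ m := by exact_mod_cast Finset.mem_range.1 hi
    have hi0 : (0 : ℝ) ≤ i := by positivity
    rw [hGcos, ← Real.cos_abs]
    refine Real.cos_le_cos_of_nonneg_of_le_pi (abs_nonneg _) hmπ ?_
    rw [abs_mul, abs_of_pos Real.two_pi_pos, abs_div, Nat.abs_cast]
    gcongr
    exact abs_le.2 ⟨by linarith, by linarith⟩
  have hhigh : ∀ i ∈ Finset.range q, i ∉ Finset.range m → G i ≤ lam := by
    intro i hi him
    have hi' : (i : ℝ) + 1 ≤ q := by exact_mod_cast Finset.mem_range.1 hi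
    have him' : (m : ℝ) ≤ i := by exact_mod_cast not_lt.1 fun h => him (Finset.mem_range.2 h)
    rw [hGcos]
    set u : ℝ := (h₀ + i - c) / q with hu
    have hu1 : (m / 2 : ℝ) / q ≤ u := by rw [hu]; gcongr; linarith
    have hu2 : u ≤ 1 - (m / 2 : ℝ) / q := by
      rw [hu, div_le_iff₀ hq0, sub_mul, div_mul_cancel₀ _ hq0.ne']
      linarith
    have hm0 : 0 ≤ (m / 2 : ℝ) / q := by positivity
    rcases le_total u (1 / 2) with h | h
    · exact Real.cos_le_cos_of_nonneg_of_le_pi (by positivity) (by nlinarith)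
        (by gcongr)
    · rw [← Real.cos_two_pi_sub]
      exact Real.cos_le_cos_of_nonneg_of_le_pi (by positivity) (by nlinarith) (by nlinarith)
  -- `h₀ + φ h` is the representative of `h` modulo `q` in the window of length `q` starting at
  -- `h₀`.
  let φ : ℕ → ℕ := fun h => (((h : ℤ) - h₀) % q).toNat
  have hφ : ∀ h : ℕ, ((φ h : ℕ) : ℤ) = ((h : ℤ) - h₀) % q :=
    fun h => Int.toNat_of_nonneg (Int.emod_nonneg _ hqz.ne')
  have hφq : ∀ h, φ h ∈ Finset.range q := by
    intro h
    rw [Finset.mem_range]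
    have := Int.emod_lt_of_pos ((h : ℤ) - h₀) hqz
    rw [← hφ] at this
    exact_mod_cast this
  have hφinj : Set.InjOn φ A := by
    intro h hh h' hh' e
    have e1 : ((h : ℤ) - h₀) % q = ((h' : ℤ) - h₀) % q := by rw [← hφ, ← hφ, e]
    have e2 : (h : ℤ) ≡ h' [ZMOD q] := by
      have := Int.ModEq.add_right h₀ (show (h : ℤ) - h₀ ≡ h' - h₀ [ZMOD q] from e1)
      simpa using this
    have e3 : h ≡ h' [MOD q] := (Int.natCast_modEq_iff).1 e2
    exact Nat.ModEq.eq_of_lt_of_lt e3 (Finset.mem_range.1 (hA hh)) (Finset.mem_range.1 (hA hh'))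
  have hgφ : ∀ h : ℕ, g h = G (φ h) := by
    intro h
    have h1 := Int.emod_add_mul_ediv ((h : ℤ) - h₀) q
    rw [← hφ] at h1
    have h2 : ((h : ℤ) : ℝ) = ((h₀ + φ h : ℤ) : ℝ) + q * (((h : ℤ) - h₀) / q : ℤ) := by
      have : (h : ℤ) = h₀ + φ h + q * (((h : ℤ) - h₀) / q) := by linarith
      exact_mod_cast this
    simp only [hG, hg]
    rw [h2]
    have h3 : (((h₀ + φ h : ℤ) : ℝ) + q * (((h : ℤ) - h₀) / q : ℤ) - c) / q
        = (((h₀ + φ h : ℤ) : ℝ) - c) / q + (((h : ℤ) - h₀) / q : ℤ) := by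
      field_simp
      ring
    rw [h3, unitExp_add, unitExp_intCast, mul_one]
  have hsumG : ∑ h ∈ A, g h ≤ ∑ i ∈ Finset.range m, G i := by
    have h1 : ∑ h ∈ A, g h = ∑ i ∈ A.image φ, G i := by
      rw [Finset.sum_image hφinj]
      exact Finset.sum_congr rfl fun h _ => hgφ h
    have hcard : (A.image φ).card = m := Finset.card_image_of_injOn hφinj
    -- After subtracting `lam`, terms are nonnegative on the first `m` places and nonpositive
    -- elsewhere; the subtraction cancels since both index sets have `m` elements.
    have h2 : ∑ i ∈ A.image φ, (G i - lam) ≤ ∑ i ∈ Finset.range m, (G i - lam) := by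
      rw [← Finset.sum_filter_add_sum_filter_not (A.image φ) (· ∈ Finset.range m)]
      have h3 : ∑ i ∈ (A.image φ).filter (· ∉ Finset.range m), (G i - lam) ≤ 0 := by
        refine Finset.sum_nonpos fun i hi => ?_
        obtain ⟨hi1, hi2⟩ := Finset.mem_filter.1 hi
        obtain ⟨h, -, rfl⟩ := Finset.mem_image.1 hi1
        exact sub_nonpos.2 (hhigh _ (hφq h) hi2)
      have h4 : ∑ i ∈ (A.image φ).filter (· ∈ Finset.range m), (G i - lam)
          ≤ ∑ i ∈ Finset.range m, (G i - lam) :=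
        Finset.sum_le_sum_of_subset_of_nonneg (fun i hi => (Finset.mem_filter.1 hi).2)
          fun i hi _ => sub_nonneg.2 (hlow i hi)
      linarith
    rw [Finset.sum_sub_distrib, Finset.sum_sub_distrib, Finset.sum_const, Finset.sum_const, hcard,
      Finset.card_range] at h2
    rw [h1]
    linarith
  have hD : ∑ i ∈ Finset.range m, G i
      = (unitExp ((h₀ - c) / q) * expSum (Finset.range m) ((q : ℝ)⁻¹)).re := by
    rw [expSum, Finset.mul_sum, Complex.re_sum]
    refine Finset.sum_congr rfl fun i _ => ?_
    rw [← unitExp_add]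
    simp only [hG, hg]
    congr 2
    push_cast
    field_simp
    ring
  rw [hsumA]
  refine hsumG.trans (hD.trans_le ((Complex.re_le_norm _).trans_eq ?_))
  rw [norm_mul, norm_unitExp, one_mul]

/-- The supremum of `2 sin² x / (π x)` over the positive reals. -/
noncomputable def sinSup : ℝ :=
  sSup ((fun x : ℝ => 2 * Real.sin x ^ 2 / (Real.pi * x)) '' Set.Ioi 0)

lemma bddAbove_sin_image :
    BddAbove ((fun x : ℝ => 2 * Real.sin x ^ 2 / (Real.pi * x)) '' Set.Ioi 0) := by
  refine ⟨2 / Real.pi, ?_⟩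
  rintro _ ⟨x, hx, rfl⟩
  have hx0 : 0 < x := hx
  have hπ := Real.pi_pos
  simp only
  rw [div_le_div_iff₀ (by positivity) hπ]
  have h1 : Real.sin x ^ 2 ≤ x := by
    have h2 := Real.abs_sin_le_one x
    have h3 : |Real.sin x| ≤ |x| := Real.abs_sin_le_abs
    rw [abs_of_pos hx0] at h3
    rw [← sq_abs]
    nlinarith [abs_nonneg (Real.sin x)]
  nlinarith

lemma two_mul_sin_sq_le {x : ℝ} (hx : 0 < x) :
    2 * Real.sin x ^ 2 ≤ sinSup * (Real.pi * x) := by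
  have h := le_csSup bddAbove_sin_image (Set.mem_image_of_mem
    (fun x : ℝ => 2 * Real.sin x ^ 2 / (Real.pi * x)) (Set.mem_Ioi.2 hx))
  have hπ := Real.pi_pos
  rwa [div_le_iff₀ (by positivity)] at h

/-- Consecutive roots are the worst case, and for them the definition of `sinSup` is applied at `x =
πm/q` with `m = A.card`. The bound is linear in `m`, so it can be summed over Fourier coefficients.
-/
lemma norm_expSum_inv_sq_le {q : ℕ} (hq : 2 ≤ q) {A : Finset ℕ} (hA : A ⊆ Finset.range q) :
    2 * ‖expSum A ((q : ℝ)⁻¹)‖ ^ 2 * (q * Real.sin (Real.pi * (q : ℝ)⁻¹)) ^ 2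
      ≤ sinSup * Real.pi ^ 2 * q * A.card := by
  have hπ := Real.pi_pos
  have hq0 : (0 : ℝ) < q := by exact_mod_cast (by omega : 0 < q)
  have hs := sin_pi_mul_inv_pos hq
  rcases Nat.eq_zero_or_pos A.card with h0 | h0
  · rw [Finset.card_eq_zero.1 h0]
    simp [expSum]
  have hm0 : (0 : ℝ) < A.card := by exact_mod_cast h0
  have hmq : A.card ≤ q := by simpa using Finset.card_le_card hA
  have h1 := norm_expSum_inv_le (by omega : 1 ≤ q) hA
  have h2 := norm_expSum_range_inv_mul_sin (by omega : 1 ≤ q) hmq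
  have h3 := two_mul_sin_sq_le (x := Real.pi * (A.card * (q : ℝ)⁻¹)) (by positivity)
  rw [← h2] at h3
  have h4 : ‖expSum A ((q : ℝ)⁻¹)‖ ^ 2 ≤ ‖expSum (Finset.range A.card) ((q : ℝ)⁻¹)‖ ^ 2 := by
    gcongr
  generalize ‖expSum A ((q : ℝ)⁻¹)‖ = a at h4 ⊢
  generalize ‖expSum (Finset.range A.card) ((q : ℝ)⁻¹)‖ = d at h3 h4
  generalize Real.sin (Real.pi * (q : ℝ)⁻¹) = s at hs h3 ⊢
  calc 2 * a ^ 2 * (q * s) ^ 2 ≤ 2 * d ^ 2 * (q * s) ^ 2 := by gcongr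
    _ = 2 * (d * s) ^ 2 * q ^ 2 := by ring
    _ ≤ sinSup * (Real.pi * (Real.pi * (A.card * (q : ℝ)⁻¹))) * q ^ 2 := by gcongr
    _ = _ := by field_simp

lemma integral_norm_torusIdempotent_sq (H : Finset ℕ) :
    ∫ t : UnitAddCircle, ‖torusIdempotent H t‖ ^ 2 = H.card := by
  have h := integral_norm_sum_fourier_sq H (fun h : ℕ => (h : ℤ))
    Nat.cast_injective.injOn (fun _ => 1)
  simp only [one_mul, norm_one, one_pow, Finset.sum_const, nsmul_eq_mul, mul_one] at h
  exact h

lemma torusIdempotent_range_sub (q : ℕ) (c : ℝ) (t : UnitAddCircle) :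
    torusIdempotent (Finset.range q) (t - (c : UnitAddCircle))
      = ∑ j ∈ Finset.range q, unitExp (j * -c) * fourier (j : ℤ) t := by
  refine Finset.sum_congr rfl fun j _ => ?_
  induction t using QuotientAddGroup.induction_on with
  | H x =>
    have h1 := fourier_coe_eq_unitExp j (x - c)
    have h2 := fourier_coe_eq_unitExp j x
    rw [Int.cast_natCast] at h1 h2
    refine h1.trans ((?_ : _ = unitExp (j * -c) * unitExp (j * x)).trans
      (congrArg (unitExp (j * -c) * ·) h2.symm))
    rw [← unitExp_add]
    congr 1
    ring

/-- The coefficient of the product at `l` is the sum of `e(-j/q)` over those `j < q` with `l - j ∈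
H`, a sum of distinct `q`-th roots of unity. Parseval and the linear bound reduce the claim to
counting all pairs `(h, j)`, of which there are `q` times `H.card`. -/
lemma integral_norm_mul_range_sq_le {q : ℕ} (hq : 2 ≤ q) (H : Finset ℕ) :
    2 * (q * Real.sin (Real.pi * (q : ℝ)⁻¹)) ^ 2 * ∫ t : UnitAddCircle,
      ‖torusIdempotent H t * torusIdempotent (Finset.range q)
        (t - (((q : ℝ)⁻¹ : ℝ) : UnitAddCircle))‖ ^ 2
      ≤ sinSup * Real.pi ^ 2 * q ^ 2 * H.card := by
  set s := H ×ˢ Finset.range q with hs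
  set T := s.image fun x => x.1 + x.2 with hT
  set fib : ℕ → Finset (ℕ × ℕ) := fun l => s.filter fun x => x.1 + x.2 = l with hfib
  have hmaps : ∀ x ∈ s, x.1 + x.2 ∈ T := fun x hx => Finset.mem_image_of_mem _ hx
  have hinj : ∀ l, Set.InjOn Prod.snd (fib l : Set (ℕ × ℕ)) := by
    rintro l ⟨a, b⟩ hx ⟨a', b'⟩ hx' h
    have h1 := (Finset.mem_filter.1 hx).2
    have h2 := (Finset.mem_filter.1 hx').2
    simp only at h h1 h2
    subst h
    rw [Prod.mk.injEq]
    exact ⟨by omega, rfl⟩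
  have hcoef : ∀ l, ∑ x ∈ fib l, unitExp (x.2 * -(q : ℝ)⁻¹)
      = expSum ((fib l).image Prod.snd) (-(q : ℝ)⁻¹) := by
    intro l
    rw [expSum, Finset.sum_image (hinj l)]
  have hsub : ∀ l, (fib l).image Prod.snd ⊆ Finset.range q := by
    intro l j hj
    obtain ⟨x, hx, rfl⟩ := Finset.mem_image.1 hj
    exact (Finset.mem_product.1 (Finset.mem_filter.1 hx).1).2
  have hexp : ∀ t : UnitAddCircle, torusIdempotent H t * torusIdempotent (Finset.range q)
        (t - (((q : ℝ)⁻¹ : ℝ) : UnitAddCircle))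
      = ∑ l ∈ T, expSum ((fib l).image Prod.snd) (-(q : ℝ)⁻¹) * fourier (l : ℤ) t := by
    intro t
    have h1 : torusIdempotent H t * torusIdempotent (Finset.range q)
        (t - (((q : ℝ)⁻¹ : ℝ) : UnitAddCircle))
        = ∑ x ∈ s, unitExp (x.2 * -(q : ℝ)⁻¹) * fourier ((x.1 + x.2 : ℕ) : ℤ) t := by
      rw [torusIdempotent_range_sub, torusIdempotent, Finset.sum_mul_sum, hs, Finset.sum_product]
      refine Finset.sum_congr rfl fun h _ => Finset.sum_congr rfl fun j _ => ?_
      rw [Nat.cast_add, fourier_add]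
      ring
    rw [h1, ← Finset.sum_fiberwise_of_maps_to hmaps]
    refine Finset.sum_congr rfl fun l _ => ?_
    rw [← hcoef, Finset.sum_mul]
    exact Finset.sum_congr rfl fun x hx => by rw [(Finset.mem_filter.1 hx).2]
  have hcard : ∑ l ∈ T, (((fib l).image Prod.snd).card : ℝ) = H.card * q := by
    have h1 := Finset.card_eq_sum_card_fiberwise hmaps
    rw [hs, Finset.card_product, Finset.card_range] at h1
    have h2 : ∑ l ∈ T, ((fib l).image Prod.snd).card = ∑ l ∈ T, (fib l).card :=
      Finset.sum_congr rfl fun l _ => Finset.card_image_of_injOn (hinj l)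
    rw [← Nat.cast_mul, h1, ← Nat.cast_sum, h2]
  simp only [hexp]
  rw [integral_norm_sum_fourier_sq T (fun l : ℕ => (l : ℤ))
    Nat.cast_injective.injOn]
  simp only [norm_expSum_neg]
  rw [Finset.mul_sum]
  have hbound : ∀ l ∈ T, 2 * (q * Real.sin (Real.pi * (q : ℝ)⁻¹)) ^ 2 *
      ‖expSum ((fib l).image Prod.snd) ((q : ℝ)⁻¹)‖ ^ 2
      ≤ sinSup * Real.pi ^ 2 * q * ((fib l).image Prod.snd).card := by
    intro l _
    refine le_trans (le_of_eq ?_) (norm_expSum_inv_sq_le hq (hsub l))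
    ring
  refine (Finset.sum_le_sum hbound).trans_eq ?_
  rw [← Finset.mul_sum, hcard]
  ring

/-- The test set consists of small arcs around `±1/q`. On the arc at `1/q` the factor `D_q(t - 1/q)`
has modulus at least `(1-ε)q`, so the mass of any idempotent there is controlled by the `L²` norm of
the product. -/
lemma le_of_isTorusConcentrationConstant_two {γ : ℝ} (hγ : IsTorusConcentrationConstant 2 γ)
    {q : ℕ} (hq : 2 ≤ q) {ε : ℝ} (hε : 0 < ε) (hε' : ε < 1) :
    γ * (q * Real.sin (Real.pi * (q : ℝ)⁻¹)) ^ 2 * (1 - ε) ^ 2 ≤ sinSup * Real.pi ^ 2 := by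
  have hq0 : (0 : ℝ) < q := by exact_mod_cast (by omega : 0 < q)
  have hs := sin_pi_mul_inv_pos hq
  obtain ⟨r, hr0, hr1, hr⟩ : ∃ r : ℝ, 0 < r ∧ r < 1 / 2 ∧ ∀ u : UnitAddCircle, ‖u‖ ≤ r →
      (1 - ε) * q ≤ ‖torusIdempotent (Finset.range q) u‖ := by
    have hc := ((continuous_torusIdempotent (Finset.range q)).norm).continuousAt (x := 0)
    have h0 : ‖torusIdempotent (Finset.range q) 0‖ = q := by simp [torusIdempotent]
    have hev := hc.eventually (lt_mem_nhds (show (1 - ε) * q < ‖torusIdempotent (Finset.range q) 0‖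
      by rw [h0]; nlinarith))
    obtain ⟨δ, hδ, hball⟩ := Metric.eventually_nhds_iff.1 hev
    refine ⟨min (δ / 2) (1 / 4), by positivity,
      (min_le_right _ _).trans_lt (by norm_num), fun u hu => (hball ?_).le⟩
    rw [dist_zero_right]
    linarith [min_le_left (δ / 2) (1 / 4)]
  set J : Set UnitAddCircle := circleArc (q : ℝ)⁻¹ r with hJ
  have hJm : MeasurableSet J := measurableSet_circleArc _ _
  have hJm' : MeasurableSet (Neg.neg ⁻¹' J : Set UnitAddCircle) := measurable_neg hJm
  have hsymm : ∀ t ∈ J ∪ Neg.neg ⁻¹' J, -t ∈ J ∪ Neg.neg ⁻¹' J := by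
    rintro t (ht | ht)
    · exact Or.inr (by rwa [Set.mem_preimage, neg_neg])
    · exact Or.inl ht
  have hpos : 0 < volume (J ∪ Neg.neg ⁻¹' J) := by
    refine lt_of_lt_of_le ?_ (measure_mono Set.subset_union_left)
    rw [hJ, circleArc, AddCircle.volume_closedBall, ENNReal.ofReal_pos]
    exact lt_min one_pos (by linarith)
  obtain ⟨H, hH, hineq⟩ := hγ _ (hJm.union hJm').nullMeasurableSet hsymm hpos
  simp only [Real.rpow_two] at hineq
  rw [integral_norm_torusIdempotent_sq] at hineq
  set F : UnitAddCircle → ℝ := fun t => ‖torusIdempotent H t‖ ^ 2 with hF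
  have hFc : Continuous F := (continuous_torusIdempotent H).norm.pow 2
  have hFi : Integrable F :=
    hFc.integrable_of_hasCompactSupport (HasCompactSupport.of_compactSpace _)
  have hcard : (0 : ℝ) < H.card := by exact_mod_cast hH.card_pos
  -- The two arcs may overlap; only subadditivity is needed.
  have hunion : ∫ t in J ∪ Neg.neg ⁻¹' J, F t ≤ 2 * ∫ t in J, F t := by
    have hmp : MeasurePreserving (Neg.neg : UnitAddCircle → UnitAddCircle) volume volume :=
      Measure.measurePreserving_neg volume
    have h := hmp.setIntegral_preimage_emb (MeasurableEquiv.neg UnitAddCircle).measurableEmbedding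
      F J
    simp only [hF, norm_torusIdempotent_neg] at h
    have h2 : ∫ t in J ∪ Neg.neg ⁻¹' J, F t
        = (∫ t in J, F t) + ∫ t in Neg.neg ⁻¹' J \ J, F t := by
      rw [← Set.union_sdiff_self]
      exact setIntegral_union Set.disjoint_sdiff_right (hJm'.diff hJm) hFi.integrableOn
        hFi.integrableOn
    have h3 : ∫ t in Neg.neg ⁻¹' J \ J, F t ≤ ∫ t in Neg.neg ⁻¹' J, F t :=
      setIntegral_mono_set hFi.integrableOn (Eventually.of_forall fun _ => by positivity)
        (Eventually.of_forall Set.sdiff_subset)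
    linarith
  set W : UnitAddCircle → ℝ := fun t => ‖torusIdempotent H t * torusIdempotent (Finset.range q)
        (t - (((q : ℝ)⁻¹ : ℝ) : UnitAddCircle))‖ ^ 2 with hW
  have hWc : Continuous W := by
    have h1 := continuous_torusIdempotent H
    have h2 := continuous_torusIdempotent (Finset.range q)
    fun_prop
  have hWi : Integrable W :=
    hWc.integrable_of_hasCompactSupport (HasCompactSupport.of_compactSpace _)
  have hJW : ((1 - ε) * q) ^ 2 * ∫ t in J, F t ≤ ∫ t, W t := by
    refine le_trans ?_ (setIntegral_le_integral hWi (Eventually.of_forall fun _ => by positivity)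
      (s := J))
    rw [← integral_const_mul]
    refine setIntegral_mono_on (hFi.const_mul _).integrableOn hWi.integrableOn hJm ?_
    intro t ht
    have h1 : ‖t - (((q : ℝ)⁻¹ : ℝ) : UnitAddCircle)‖ ≤ r := by
      rw [← dist_eq_norm]
      exact Metric.mem_closedBall.1 ht
    have h2 := hr _ h1
    have h3 : 0 ≤ (1 - ε) * q := mul_nonneg (by linarith) hq0.le
    have h4 : ((1 - ε) * q) ^ 2 ≤ ‖torusIdempotent (Finset.range q)
        (t - (((q : ℝ)⁻¹ : ℝ) : UnitAddCircle))‖ ^ 2 := pow_le_pow_left₀ h3 h2 2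
    calc ((1 - ε) * q) ^ 2 * ‖torusIdempotent H t‖ ^ 2
        ≤ ‖torusIdempotent (Finset.range q) (t - (((q : ℝ)⁻¹ : ℝ) : UnitAddCircle))‖ ^ 2 *
          ‖torusIdempotent H t‖ ^ 2 := mul_le_mul_of_nonneg_right h4 (by positivity)
      _ = W t := by simp only [hW, norm_mul]; ring
  have hmain := integral_norm_mul_range_sq_le hq H
  have h5 := mul_le_mul_of_nonneg_left hJW
    (by positivity : 0 ≤ 2 * (q * Real.sin (Real.pi * (q : ℝ)⁻¹)) ^ 2)
  have h6 := hineq.trans hunion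
  set θ := (q * Real.sin (Real.pi * (q : ℝ)⁻¹)) ^ 2 with hθ
  have hθ0 : 0 ≤ θ := by positivity
  have h7 := mul_le_mul_of_nonneg_left h6 (by positivity : 0 ≤ θ * ((1 - ε) * q) ^ 2)
  refine le_of_mul_le_mul_right (a := (q : ℝ) ^ 2 * H.card) ?_ (by positivity)
  calc γ * θ * (1 - ε) ^ 2 * ((q : ℝ) ^ 2 * H.card)
      = θ * ((1 - ε) * q) ^ 2 * (γ * H.card) := by ring
    _ ≤ _ := h7
    _ = 2 * θ * (((1 - ε) * q) ^ 2 * ∫ t in J, F t) := by ring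
    _ ≤ _ := h5
    _ ≤ _ := hmain
    _ = _ := by ring

/-- In the preceding bound let `q → ∞`, where `q sin(π/q) → π`, and then `ε → 0`. -/
lemma torusLevel_two_le_sinSup : torusLevel 2 ≤ sinSup := by
  refine csSup_le ⟨0, isTorusConcentrationConstant_zero 2⟩ fun γ hγ => ?_
  have hπ := Real.pi_pos
  have h1 : ∀ ε : ℝ, 0 < ε → ε < 1 → γ * Real.pi ^ 2 * (1 - ε) ^ 2 ≤ sinSup * Real.pi ^ 2 := by
    intro ε hε hε'
    refine le_of_tendsto (((tendsto_natCast_mul_sin_pi_mul_inv.pow 2).const_mul γ).mul_const _) ?_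
    filter_upwards [eventually_ge_atTop 2] with q hq
    exact le_of_isTorusConcentrationConstant_two hγ hq hε hε'
  have h2 : γ * Real.pi ^ 2 ≤ sinSup * Real.pi ^ 2 := by
    have hc : Tendsto (fun ε : ℝ => γ * Real.pi ^ 2 * (1 - ε) ^ 2) (𝓝[>] 0)
        (𝓝 (γ * Real.pi ^ 2 * (1 - 0) ^ 2)) :=
      ((by fun_prop : Continuous fun ε : ℝ => γ * Real.pi ^ 2 * (1 - ε) ^ 2).tendsto
        0).mono_left nhdsWithin_le_nhds
    rw [sub_zero, one_pow, mul_one] at hc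
    refine le_of_tendsto hc ?_
    filter_upwards [self_mem_nhdsWithin, nhdsWithin_le_nhds (gt_mem_nhds one_pos)] with ε h h'
    exact h1 ε h h'
  exact le_of_mul_le_mul_right h2 (by positivity)

lemma sinSup_le_cyclicLevel_two : sinSup ≤ cyclicLevel 2 := by
  refine csSup_le (Set.image_nonempty.2 ⟨1, Set.mem_Ioi.2 one_pos⟩) ?_
  rintro _ ⟨x, hx, rfl⟩
  exact le_cyclicLevel_two hx

theorem proposition3p1 :
    (∀ p : ℝ, 1 < p → cyclicLevel p ≤ torusLevel p ∧ cyclicPrimeLevel p ≤ torusLevel p) ∧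
    torusLevel 2 = cyclicLevel 2 ∧
    torusLevel 2 = cyclicPrimeLevel 2 ∧
    torusLevel 2 =
      sSup ((fun x : ℝ => 2 * Real.sin x ^ 2 / (Real.pi * x)) '' Set.Ioi 0) := by
  -- The inequalities close up into a cycle: `torusLevel 2 ≤ sinSup ≤ cyclicLevel 2 ≤
  -- cyclicPrimeLevel 2 ≤ torusLevel 2`.
  have h1 := cyclicLevel_le_cyclicPrimeLevel 2
  have h2 := cyclicPrimeLevel_le_torusLevel (p := 2) one_lt_two
  have h3 := torusLevel_two_le_sinSup
  have h4 := sinSup_le_cyclicLevel_two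
  refine ⟨fun p hp => ⟨(cyclicLevel_le_cyclicPrimeLevel p).trans (cyclicPrimeLevel_le_torusLevel hp),
    cyclicPrimeLevel_le_torusLevel hp⟩, ?_, ?_, ?_⟩
  · linarith
  · linarith
  · change torusLevel 2 = sinSup
    linarith
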